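/- Let $H$ be a complex Hilbert space. For $1\le p<\infty$ let $\ell^p(H)$ denote the Schatten–von Neumann ideal of compact operators $T$ on $H$ with $\operatorname{Trace}\big((T^*T)^{p/2}\big)<\infty$, normed by $\|T\|_p=\operatorname{Trace}\big((T^*T)^{p/2}\big)^{1/p}$, and let $S(\ell^p(H))=\{T\in\ell^p(H):\|T\|_p=1\}$ be its unit sphere with the metric induced by $\|\cdot\|_p$. For a bounded operator $T$ on $H$ put $|T|=(T^*T)^{1/2}$ and let $\operatorname{sign}(T)$ be the partial isometry in the polar decomposition of $T$, that is, the unique bounded operator with $T=\operatorname{sign}(T)\,|T|$ and $\ker\operatorname{sign}(T)=\ker T$. **Corollary.** Let $1<p,q<\infty$. Then the noncommutative Mazur map $$M_{p,q}(T)=\operatorname{sign}(T)\,|T|^{p/q}$$ maps $S(\ell^p(H))$ into $S(\ell^q(H))$ and is a uniformly continuous homeomorphism from $S(\ell^p(H))$ onto $S(\ell^q(H))$; its inverse is $M_{q,p}$, which is uniformly continuous as well. -/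

import Mathlib

universe u v

namespace NCMazur

noncomputable section

open scoped ENNReal InnerProductSpace

set_option linter.unusedSectionVars false

variable {H : Type u} [NormedAddCommGroup H] [InnerProductSpace ℂ H] [CompleteSpace H]

theorem cfc_apply_eigenvector {A : H →L[ℂ] H} (hA : IsSelfAdjoint A) {l : ℝ} {x : H}
    (hx : A x = (l : ℂ) • x) (hx0 : x ≠ 0) (f : ℝ → ℝ) (hf : ContinuousOn f (spectrum ℝ A)) :
    cfc f A x = ((f l : ℝ) : ℂ) • x := by
  have hl : l ∈ spectrum ℝ A := by
    rw [spectrum.mem_iff]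
    rintro ⟨u, hu⟩
    have h1 : (u : H →L[ℂ] H) x = 0 := by
      rw [hu]
      simp [hx, Algebra.algebraMap_eq_smul_one]
    have h2 : ((u⁻¹ : (H →L[ℂ] H)ˣ) : H →L[ℂ] H) ((u : H →L[ℂ] H) x) = x := by
      rw [← mul_apply_eq_comp, Units.inv_mul]; rfl
    rw [h1, map_zero] at h2
    exact hx0 h2.symm
  have key : ∀ g : C(spectrum ℝ A, ℝ), cfcHom hA g x = ((g ⟨l, hl⟩ : ℝ) : ℂ) • x := by
    intro g
    induction g using ContinuousMap.induction_on_of_compact with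
    | const r =>
      have : (ContinuousMap.const (spectrum ℝ A) r) = algebraMap ℝ C(spectrum ℝ A, ℝ) r := rfl
      rw [this, AlgHomClass.commutes]
      simp [Algebra.algebraMap_eq_smul_one]
    | id => rw [cfcHom_id hA]; simpa using hx
    | star_id => rw [map_star, cfcHom_id hA, hA.star_eq]; simpa using hx
    | add f g h₁ h₂ => simp [h₁, h₂, add_smul]
    | mul f g h₁ h₂ =>
      simp only [map_mul, mul_apply_eq_comp, h₁, h₂, map_smul, ContinuousMap.mul_apply,
        Complex.ofReal_mul, mul_smul]
      rw [smul_comm]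
    | frequently f h =>
      refine h.mem_of_closed <| isClosed_eq ?_ ?_
      · exact (ContinuousLinearMap.apply ℂ H x).continuous.comp (cfcHom_continuous hA)
      · fun_prop
  rw [cfc_apply f A hA hf, key]
  rfl

theorem rpow_apply_eigenvector {A : H →L[ℂ] H} (hA : 0 ≤ A) {l : ℝ} {x : H}
    (hx : A x = (l : ℂ) • x) (hx0 : x ≠ 0) {r : ℝ} (hr : 0 ≤ r) :
    (A ^ r) x = ((l ^ r : ℝ) : ℂ) • x := by
  rw [CFC.rpow_eq_cfc_real hA]
  exact cfc_apply_eigenvector (IsSelfAdjoint.of_nonneg hA) hx hx0 _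
    (fun t _ => (Real.continuousAt_rpow_const t r (Or.inr hr)).continuousWithinAt)

theorem exists_hilbertBasis_sigma {κ : Type*} {V : κ → Submodule ℂ H} {w : κ → Type*}
    (hV : OrthogonalFamily ℂ (fun μ => V μ) fun μ => (V μ).subtypeₗᵢ)
    (b : ∀ μ, HilbertBasis (w μ) ℂ (V μ)) (hbot : (⨆ μ, V μ)ᗮ = ⊥) :
    ∃ g : HilbertBasis (Σ μ, w μ) ℂ H, ∀ i, g i ∈ V i.1 := by
  have hon := hV.orthonormal_sigma_orthonormal (v_family := fun μ => b μ)
    (fun μ => (b μ).orthonormal)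
  have hspan : (Submodule.span ℂ (Set.range fun a : Σ μ, w μ =>
      (V a.1).subtypeₗᵢ (b a.1 a.2)))ᗮ = ⊥ := by
    rw [eq_bot_iff, ← hbot]
    intro y hy
    rw [Submodule.mem_orthogonal'] at hy ⊢
    have : (⨆ μ, V μ) ≤ (Submodule.span ℂ {y})ᗮ := by
      refine iSup_le fun μ x hx => ?_
      rw [Submodule.mem_orthogonal_singleton_iff_inner_right]
      have hs := ((b μ).hasSum_repr ⟨x, hx⟩).mapL ((innerSL ℂ y).comp (V μ).subtypeL)
      have hz : ∀ i, ((innerSL ℂ y).comp (V μ).subtypeL)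
          ((b μ).repr ⟨x, hx⟩ i • b μ i) = 0 := by
        intro i
        have h0 : ⟪y, (b μ i : H)⟫_ℂ = 0 := hy _ (Submodule.subset_span ⟨⟨μ, i⟩, rfl⟩)
        rw [map_smul]
        simp [h0]
      simp only [hz] at hs
      exact hs.unique hasSum_zero
    intro u hu
    exact Submodule.mem_orthogonal_singleton_iff_inner_right.1 (this hu)
  refine ⟨HilbertBasis.mkOfOrthogonalEqBot hon hspan, fun a => ?_⟩
  rw [HilbertBasis.coe_mkOfOrthogonalEqBot]
  exact (b a.1 a.2).2

theorem exists_hilbertBasis_of_orthogonalFamily {κ : Type v} {V : κ → Submodule ℂ H}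
    (hV : OrthogonalFamily ℂ (fun μ => V μ) fun μ => (V μ).subtypeₗᵢ)
    (hcl : ∀ μ, CompleteSpace (V μ)) (hbot : (⨆ μ, V μ)ᗮ = ⊥) :
    ∃ (ι : Type (max v u)) (g : HilbertBasis ι ℂ H) (m : ι → κ), ∀ i, g i ∈ V (m i) := by
  obtain ⟨g, hg⟩ := exists_hilbertBasis_sigma hV
    (fun μ => (exists_hilbertBasis ℂ (V μ)).choose_spec.choose) hbot
  exact ⟨_, g, Sigma.fst, hg⟩

theorem exists_eigenbasis {A : H →L[ℂ] H} (hA : 0 ≤ A) (hc : IsCompactOperator A) :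
    ∃ (ι : Type u) (g : HilbertBasis ι ℂ H) (l : ι → ℝ),
      (∀ i, 0 ≤ l i) ∧ ∀ i, A (g i) = (l i : ℂ) • g i := by
  have hpos := (ContinuousLinearMap.nonneg_iff_isPositive A).1 hA
  have hsym : (A : H →ₗ[ℂ] H).IsSymmetric := hpos.isSymmetric
  obtain ⟨ι, g, m, hg⟩ := exists_hilbertBasis_of_orthogonalFamily
    hsym.orthogonalFamily_eigenspaces (fun μ => by
      have h2 : (Module.End.eigenspace (A : H →ₗ[ℂ] H) μ : Set H) = {x | A x = μ • x} := by
        ext x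
        exact Module.End.mem_eigenspace_iff
      have : IsClosed (Module.End.eigenspace (A : H →ₗ[ℂ] H) μ : Set H) := by
        rw [h2]
        exact isClosed_eq (by fun_prop) (by fun_prop)
      exact this.completeSpace_coe)
    (ContinuousLinearMap.orthogonalComplement_iSup_eigenspaces_eq_bot hc hsym)
  have hval : ∀ i, A (g i) = m i • g i := fun i => Module.End.mem_eigenspace_iff.1 (hg i)
  have hreal : ∀ i, 0 ≤ (m i).re ∧ (((m i).re : ℝ) : ℂ) = m i := by
    intro i
    have h1 := hpos.inner_nonneg_right (g i)
    rw [hval, inner_smul_right, inner_self_eq_norm_sq_to_K, g.orthonormal.1 i] at h1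
    simp only [map_one, one_pow, mul_one, Complex.nonneg_iff] at h1
    exact ⟨by simpa using h1.1, Complex.ext rfl (by simpa using h1.2)⟩
  exact ⟨ι, g, fun i => (m i).re, fun i => (hreal i).1, fun i => by
    rw [(hreal i).2]
    exact hval i⟩

/-- The trace `∑ i, ⟪A e i, e i⟫ ∈ [0, ∞]` of a positive bounded operator `A`, computed in a chosen
Hilbert basis `e` of `H`. By `traceNonneg_eq` it can be computed in any Hilbert basis. -/
def traceNonneg (A : H →L[ℂ] H) : ℝ≥0∞ :=
  ∑' i, ENNReal.ofReal (A.reApplyInnerSelf ((exists_hilbertBasis ℂ H).choose_spec.choose i))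

theorem enorm_sq_eq_tsum {ι : Type*} (b : HilbertBasis ι ℂ H) (x : H) :
    ‖x‖ₑ ^ 2 = ∑' i, ‖⟪b i, x⟫_ℂ‖ₑ ^ 2 := by
  have h := b.hasSum_inner_mul_inner x x
  have h2 : HasSum (fun i => ‖⟪b i, x⟫_ℂ‖ ^ 2) (‖x‖ ^ 2) := by
    have h3 := Complex.hasSum_re h
    rw [inner_self_eq_norm_sq_to_K] at h3
    convert h3 using 1
    · ext i
      rw [← inner_conj_symm x (b i), mul_comm, Complex.mul_conj, Complex.normSq_eq_norm_sq]
      norm_cast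
    · norm_cast
  have h4 := congrArg ENNReal.ofReal h2.tsum_eq
  rw [ENNReal.ofReal_tsum_of_nonneg (fun i => by positivity) h2.summable] at h4
  simpa [ENNReal.ofReal_pow, ofReal_norm] using h4.symm

theorem tsum_reApplyInnerSelf_eq {ι κ : Type*} (b : HilbertBasis ι ℂ H) (c : HilbertBasis κ ℂ H)
    {A : H →L[ℂ] H} (hA : 0 ≤ A) :
    ∑' i, ENNReal.ofReal (A.reApplyInnerSelf (b i)) =
      ∑' j, ENNReal.ofReal (A.reApplyInnerSelf (c j)) := by
  obtain ⟨B, hB, hBA⟩ : ∃ B : H →L[ℂ] H, IsSelfAdjoint B ∧ B * B = A :=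
    ⟨CFC.sqrt A, IsSelfAdjoint.of_nonneg (CFC.sqrt_nonneg A), CFC.sqrt_mul_sqrt_self A hA⟩
  have hsq : ∀ x, ENNReal.ofReal (A.reApplyInnerSelf x) = ‖B x‖ₑ ^ 2 := by
    intro x
    rw [ContinuousLinearMap.reApplyInnerSelf_apply, ← hBA, mul_apply_eq_comp,
      ← ContinuousLinearMap.adjoint_inner_right, hB.adjoint_eq, inner_self_eq_norm_sq,
      ENNReal.ofReal_pow (norm_nonneg _), ofReal_norm]
  simp_rw [hsq]
  simp_rw [fun i => enorm_sq_eq_tsum c (B (b i)), fun j => enorm_sq_eq_tsum b (B (c j))]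
  rw [ENNReal.tsum_comm]
  refine tsum_congr fun j => tsum_congr fun i => ?_
  rw [← ContinuousLinearMap.adjoint_inner_left, hB.adjoint_eq, ← inner_conj_symm]
  rw [← ofReal_norm, ← ofReal_norm, RCLike.norm_conj]

theorem traceNonneg_eq {ι : Type*} (b : HilbertBasis ι ℂ H) {A : H →L[ℂ] H} (hA : 0 ≤ A) :
    traceNonneg A = ∑' i, ENNReal.ofReal (A.reApplyInnerSelf (b i)) :=
  tsum_reApplyInnerSelf_eq _ b hA

/-- `Trace ((T* T) ^ (p / 2)) ∈ [0, ∞]`, the power being given by the continuous functional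
calculus. -/
def schattenTrace (p : ℝ) (T : H →L[ℂ] H) : ℝ≥0∞ := traceNonneg ((star T * T) ^ (p / 2))

theorem exists_singular_values {T : H →L[ℂ] H} (hT : IsCompactOperator T) :
    ∃ (ι : Type u) (g : HilbertBasis ι ℂ H) (s : ι → ℝ) (h : ι → H),
      (∀ i, 0 ≤ s i) ∧ (∀ i, T (g i) = (s i : ℂ) • h i) ∧ (∀ i, s i = 0 → h i = 0) ∧
      Orthonormal ℂ (fun i : {i // s i ≠ 0} => h i) ∧
      ∀ p : ℝ, 0 < p → schattenTrace p T = ∑' i, ENNReal.ofReal (s i) ^ p := by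
  have hA : 0 ≤ star T * T := star_mul_self_nonneg T
  obtain ⟨ι, g, l, hl, hg⟩ := exists_eigenbasis hA (hT.clm_comp (star T))
  classical
  have hin : ∀ i j, ⟪T (g i), T (g j)⟫_ℂ = (l j : ℂ) * (if i = j then 1 else 0) := by
    intro i j
    rw [← ContinuousLinearMap.adjoint_inner_right, ← ContinuousLinearMap.star_eq_adjoint,
      ← mul_apply_eq_comp, hg, inner_smul_right, orthonormal_iff_ite.1 g.orthonormal]
  have hss : ∀ i, ((√(l i) : ℝ) : ℂ) * (√(l i) : ℝ) = l i := fun i => by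
    rw [← Complex.ofReal_mul, Real.mul_self_sqrt (hl i)]
  refine ⟨ι, g, fun i => √(l i), fun i => ((√(l i) : ℝ) : ℂ)⁻¹ • T (g i),
    fun i => Real.sqrt_nonneg _, fun i => ?_, fun i hi => ?_, ?_, fun p hp => ?_⟩
  · by_cases h0 : √(l i) = 0
    · have h1 : l i = 0 := (Real.sqrt_eq_zero (hl i)).1 h0
      have h2 := hin i i
      rw [h1, Complex.ofReal_zero, zero_mul, inner_self_eq_zero] at h2
      simp [h2]
    · rw [smul_smul, mul_inv_cancel₀ (by exact_mod_cast h0), one_smul]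
  · simp [hi]
  · rw [orthonormal_iff_ite]
    rintro ⟨i, hi⟩ ⟨j, hj⟩
    have hi' : ((√(l i) : ℝ) : ℂ) ≠ 0 := by exact_mod_cast hi
    rw [inner_smul_left, inner_smul_right, hin, map_inv₀, Complex.conj_ofReal]
    by_cases hij : i = j
    · subst hij
      simp only [if_true, mul_one, ← hss i]
      field_simp
    · simp [hij]
  · rw [schattenTrace, traceNonneg,
      tsum_reApplyInnerSelf_eq _ g (CFC.rpow_nonneg (a := star T * T) (y := p / 2))]
    refine tsum_congr fun i => ?_
    have hgi : g i ≠ 0 := g.orthonormal.ne_zero i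
    rw [ContinuousLinearMap.reApplyInnerSelf_apply,
      rpow_apply_eigenvector hA (hg i) hgi (by positivity), inner_smul_left,
      inner_self_eq_norm_sq_to_K, g.orthonormal.1 i,
      ENNReal.ofReal_rpow_of_nonneg (Real.sqrt_nonneg _) hp.le, Real.sqrt_eq_rpow,
      ← Real.rpow_mul (hl i)]
    rw [show (1 / 2 * p : ℝ) = p / 2 by ring]
    simp

theorem ennreal_mul_le_half (a b : ℝ≥0∞) : a * b ≤ (a ^ 2 + b ^ 2) / 2 := by
  rw [ENNReal.le_div_iff_mul_le (by simp) (by simp)]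
  rcases eq_or_ne a ⊤ with rfl | ha
  · simp
  rcases eq_or_ne b ⊤ with rfl | hb
  · simp
  lift a to NNReal using ha
  lift b to NNReal using hb
  norm_cast
  rw [← NNReal.coe_le_coe]
  push_cast
  nlinarith [sq_nonneg ((a : ℝ) - b)]

theorem tsum_mul_le_one {ι : Type*} {a b : ι → ℝ≥0∞} (ha : ∑' i, a i ^ 2 ≤ 1)
    (hb : ∑' i, b i ^ 2 ≤ 1) : ∑' i, a i * b i ≤ 1 := by
  calc ∑' i, a i * b i ≤ ∑' i, (a i ^ 2 + b i ^ 2) / 2 :=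
        ENNReal.tsum_le_tsum fun i => ennreal_mul_le_half _ _
    _ = (∑' i, a i ^ 2 + ∑' i, b i ^ 2) / 2 := by
        simp_rw [div_eq_mul_inv]
        rw [ENNReal.tsum_mul_right, ENNReal.tsum_add]
    _ ≤ (1 + 1) / 2 := by gcongr
    _ = 1 := by rw [one_add_one_eq_two]; exact ENNReal.div_self (by simp) (by simp)

theorem tsum_weight_rpow_le {ι : Type*} {c s : ι → ℝ≥0∞} (hc : ∑' i, c i ≤ 1) {p : ℝ}
    (hp : 1 ≤ p) : (∑' i, c i * s i) ^ p ≤ ∑' i, c i * s i ^ p := by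
  have hp0 : 0 < p := by linarith
  rw [← ENNReal.le_rpow_inv_iff hp0, ENNReal.tsum_eq_iSup_sum]
  refine iSup_le fun t => (ENNReal.inner_le_weight_mul_Lp_of_nonneg t hp c s).trans ?_
  have h1 : (∑ i ∈ t, c i) ^ (1 - p⁻¹) ≤ 1 :=
    ENNReal.rpow_le_one ((ENNReal.sum_le_tsum t).trans hc) (sub_nonneg.2 (inv_le_one_of_one_le₀ hp))
  calc _ ≤ 1 * (∑' i, c i * s i ^ p) ^ p⁻¹ := by
        gcongr
        exact ENNReal.sum_le_tsum t
    _ = _ := one_mul _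

theorem tsum_Lp_add_le {ι : Type*} (a b : ι → ℝ≥0∞) {p : ℝ} (hp : 1 ≤ p) :
    (∑' i, (a i + b i) ^ p) ^ (1 / p) ≤
      (∑' i, a i ^ p) ^ (1 / p) + (∑' i, b i ^ p) ^ (1 / p) := by
  have hp0 : 0 < p := by linarith
  rw [one_div, ENNReal.rpow_inv_le_iff hp0, ENNReal.tsum_eq_iSup_sum]
  refine iSup_le fun t => ?_
  rw [← ENNReal.rpow_inv_le_iff hp0, ← one_div]
  refine (ENNReal.Lp_add_le t a b hp).trans ?_
  gcongr <;> exact ENNReal.sum_le_tsum t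

theorem tsum_enorm_inner_sq_le {ι : Type*} {v : ι → H} (hv : Orthonormal ℂ v) (x : H) :
    ∑' i, ‖⟪v i, x⟫_ℂ‖ₑ ^ 2 ≤ ‖x‖ₑ ^ 2 := by
  rw [ENNReal.tsum_eq_iSup_sum]
  refine iSup_le fun t => ?_
  have h := ENNReal.ofReal_le_ofReal (hv.sum_inner_products_le x (s := t))
  rw [ENNReal.ofReal_sum_of_nonneg (fun i _ => by positivity)] at h
  simpa [ENNReal.ofReal_pow, ofReal_norm] using h

theorem tsum_le_schattenTrace {p : ℝ} (hp : 1 ≤ p) {T : H →L[ℂ] H} (hT : IsCompactOperator T)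
    {κ : Type*} {e f : κ → H} (he : Orthonormal ℂ e) (hf : Orthonormal ℂ f) :
    ∑' k, ‖⟪f k, T (e k)⟫_ℂ‖ₑ ^ p ≤ schattenTrace p T := by
  obtain ⟨ι, g, s, h, hs, hTg, hh0, hho, htr⟩ := exists_singular_values hT
  rw [htr p (by linarith)]
  set c : κ → ι → ℝ≥0∞ := fun k i => ‖⟪g i, e k⟫_ℂ‖ₑ * ‖⟪f k, h i⟫_ℂ‖ₑ with hc
  have hsw : ∀ x y : H, ‖⟪x, y⟫_ℂ‖ₑ = ‖⟪y, x⟫_ℂ‖ₑ := fun x y => by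
    rw [← ofReal_norm, ← ofReal_norm, norm_inner_symm]
  have hrow : ∀ k, ∑' i, c k i ≤ 1 := by
    intro k
    refine tsum_mul_le_one ?_ ?_
    · exact (tsum_enorm_inner_sq_le g.orthonormal (e k)).trans
        (by rw [← ofReal_norm, he.1 k]; simp)
    · have h1 : ∑' i, ‖⟪f k, h i⟫_ℂ‖ₑ ^ 2 = ∑' i : {i // s i ≠ 0}, ‖⟪f k, h i⟫_ℂ‖ₑ ^ 2 := by
        refine (tsum_subtype_eq_of_support_subset (s := {i | s i ≠ 0}) ?_).symm
        intro i hi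
        by_contra h0
        simp only [Set.mem_ofPred_eq, not_not] at h0
        simp [hh0 i h0] at hi
      rw [h1]
      simp_rw [hsw (f k)]
      exact (tsum_enorm_inner_sq_le hho (f k)).trans (by rw [← ofReal_norm, hf.1 k]; simp)
  have hcol : ∀ i, ∑' k, c k i ≤ 1 := by
    intro i
    refine tsum_mul_le_one ?_ ?_
    · simp_rw [hsw (g i)]
      exact (tsum_enorm_inner_sq_le he (g i)).trans
        (by rw [← ofReal_norm, g.orthonormal.1 i]; simp)
    · refine (tsum_enorm_inner_sq_le hf (h i)).trans ?_
      by_cases h0 : s i = 0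
      · simp [hh0 i h0]
      · rw [← ofReal_norm, hho.1 ⟨i, h0⟩]; simp
  have hk : ∀ k, ‖⟪f k, T (e k)⟫_ℂ‖ₑ ≤ ∑' i, c k i * ENNReal.ofReal (s i) := by
    intro k
    have h1 := (g.hasSum_repr (e k)).mapL ((innerSL ℂ (f k)).comp T)
    have h2 : ⟪f k, T (e k)⟫_ℂ = ∑' i, ⟪g i, e k⟫_ℂ * ((s i : ℂ) * ⟪f k, h i⟫_ℂ) := by
      refine Eq.trans h1.tsum_eq.symm (tsum_congr fun i => ?_)
      simp [hTg, g.repr_apply_apply]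
    rw [h2]
    refine enorm_tsum_le_tsum_enorm.trans (ENNReal.tsum_le_tsum fun i => le_of_eq ?_)
    have : ‖(s i : ℂ)‖ₑ = ENNReal.ofReal (s i) := by
      rw [← ofReal_norm, Complex.norm_real, Real.norm_of_nonneg (hs i)]
    rw [enorm_mul, enorm_mul, this, hc]
    ring
  calc ∑' k, ‖⟪f k, T (e k)⟫_ℂ‖ₑ ^ p
      ≤ ∑' k, ∑' i, c k i * ENNReal.ofReal (s i) ^ p := by
        refine ENNReal.tsum_le_tsum fun k => ?_
        refine le_trans ?_ (tsum_weight_rpow_le (hrow k) hp)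
        exact ENNReal.rpow_le_rpow (hk k) (by linarith)
    _ = ∑' i, (∑' k, c k i) * ENNReal.ofReal (s i) ^ p := by
        rw [ENNReal.tsum_comm]
        simp_rw [ENNReal.tsum_mul_right]
    _ ≤ ∑' i, ENNReal.ofReal (s i) ^ p := by
        refine ENNReal.tsum_le_tsum fun i => ?_
        calc _ ≤ 1 * ENNReal.ofReal (s i) ^ p := by gcongr; exact hcol i
          _ = _ := one_mul _

theorem exists_tsum_eq_schattenTrace {p : ℝ} (hp : 1 ≤ p) {T : H →L[ℂ] H}
    (hT : IsCompactOperator T) :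
    ∃ (κ : Type u) (e f : κ → H), Orthonormal ℂ e ∧ Orthonormal ℂ f ∧
      schattenTrace p T = ∑' k, ‖⟪f k, T (e k)⟫_ℂ‖ₑ ^ p := by
  obtain ⟨ι, g, s, h, hs, hTg, hh0, hho, htr⟩ := exists_singular_values hT
  refine ⟨{i // s i ≠ 0}, fun i => g i, fun i => h i,
    g.orthonormal.comp _ Subtype.val_injective, hho, ?_⟩
  rw [htr p (by linarith)]
  have h1 : ∑' i, ENNReal.ofReal (s i) ^ p = ∑' i : {i // s i ≠ 0}, ENNReal.ofReal (s i) ^ p := by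
    refine (tsum_subtype_eq_of_support_subset (s := {i | s i ≠ 0}) ?_).symm
    intro i hi h0
    rw [Function.mem_support, h0, ENNReal.ofReal_zero, ENNReal.zero_rpow_of_pos (by linarith)] at hi
    exact hi rfl
  rw [h1]
  refine tsum_congr fun i => ?_
  rw [hTg, inner_smul_right, inner_self_eq_norm_sq_to_K, hho.1 i, ← ofReal_norm]
  simp [abs_of_nonneg (hs i)]

theorem schattenTrace_zero {p : ℝ} (hp : 0 < p) : schattenTrace p (0 : H →L[ℂ] H) = 0 := by
  have h0 : (0 : H →L[ℂ] H) ^ (p / 2) = 0 := CFC.zero_rpow (by positivity)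
  simp [schattenTrace, traceNonneg, h0, ContinuousLinearMap.reApplyInnerSelf_apply]

theorem schattenTrace_smul {p : ℝ} (hp : 1 ≤ p) (c : ℂ) {T : H →L[ℂ] H}
    (hT : IsCompactOperator T) : schattenTrace p (c • T) = ‖c‖ₑ ^ p * schattenTrace p T := by
  have hp0 : 0 ≤ p := by linarith
  have key : ∀ {κ : Type u} (e f : κ → H), ∑' k, ‖⟪f k, (c • T) (e k)⟫_ℂ‖ₑ ^ p =
      ‖c‖ₑ ^ p * ∑' k, ‖⟪f k, T (e k)⟫_ℂ‖ₑ ^ p := by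
    intro κ e f
    rw [← ENNReal.tsum_mul_left]
    refine tsum_congr fun k => ?_
    rw [smul_apply, inner_smul_right, enorm_mul, ENNReal.mul_rpow_of_nonneg _ _ hp0]
  apply le_antisymm
  · obtain ⟨κ, e, f, he, hf, h⟩ := exists_tsum_eq_schattenTrace (T := c • T) hp (hT.smul c)
    refine h.le.trans ((key e f).le.trans ?_)
    gcongr
    exact tsum_le_schattenTrace hp hT he hf
  · obtain ⟨κ, e, f, he, hf, h⟩ := exists_tsum_eq_schattenTrace hp hT
    rw [h, ← key]
    exact tsum_le_schattenTrace hp (hT.smul c) he hf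

theorem schattenTrace_add_le {p : ℝ} (hp : 1 ≤ p) {S T : H →L[ℂ] H}
    (hS : IsCompactOperator S) (hT : IsCompactOperator T) :
    schattenTrace p (S + T) ^ (1 / p) ≤
      schattenTrace p S ^ (1 / p) + schattenTrace p T ^ (1 / p) := by
  have hp0 : 0 < p := by linarith
  obtain ⟨κ, e, f, he, hf, h⟩ := exists_tsum_eq_schattenTrace (T := S + T) hp (hS.add hT)
  rw [h]
  calc (∑' k, ‖⟪f k, (S + T) (e k)⟫_ℂ‖ₑ ^ p) ^ (1 / p)
      ≤ (∑' k, (‖⟪f k, S (e k)⟫_ℂ‖ₑ + ‖⟪f k, T (e k)⟫_ℂ‖ₑ) ^ p) ^ (1 / p) := by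
        gcongr with k
        rw [add_apply, inner_add_right]
        exact enorm_add_le _ _
    _ ≤ _ := tsum_Lp_add_le _ _ hp
    _ ≤ _ := by
        gcongr
        · exact tsum_le_schattenTrace hp hS he hf
        · exact tsum_le_schattenTrace hp hT he hf

theorem eq_zero_of_schattenTrace_eq_zero {p : ℝ} (hp : 0 < p) {T : H →L[ℂ] H}
    (hT : IsCompactOperator T) (h : schattenTrace p T = 0) : T = 0 := by
  obtain ⟨ι, g, s, h', hs, hTg, hh0, hho, htr⟩ := exists_singular_values hT
  rw [htr p hp, ENNReal.tsum_eq_zero] at h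
  ext x
  have h1 := (g.hasSum_repr x).mapL T
  have h2 : ∀ i, T (g.repr x i • g i) = 0 := by
    intro i
    have h3 := (ENNReal.rpow_eq_zero_iff_of_pos hp).1 (h i)
    have h4 : s i = 0 := le_antisymm (ENNReal.ofReal_eq_zero.1 h3) (hs i)
    rw [map_smul, hTg, h4]; simp
  simp only [h2] at h1
  exact h1.unique hasSum_zero

/-- The Schatten-von Neumann ideal `ℓ^p(H)`: the compact operators `T` on `H` with
`Trace ((T* T) ^ (p / 2)) < ∞`, as a linear subspace of the bounded operators. -/
def schattenIdeal (p : ℝ) [hp : Fact (1 ≤ p)] (H : Type u) [NormedAddCommGroup H]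
    [InnerProductSpace ℂ H] [CompleteSpace H] : Submodule ℂ (H →L[ℂ] H) where
  carrier := {T | IsCompactOperator T ∧ schattenTrace p T < ∞}
  zero_mem' := ⟨isCompactOperator_zero, by
    rw [schattenTrace_zero (by linarith [hp.out])]; exact ENNReal.zero_lt_top⟩
  add_mem' := by
    rintro S T ⟨hS, hS'⟩ ⟨hT, hT'⟩
    have hp0 : 0 < 1 / p := one_div_pos.2 (by linarith [hp.out])
    refine ⟨hS.add hT, ?_⟩
    rw [← ENNReal.rpow_lt_top_iff_of_pos hp0]
    refine (schattenTrace_add_le hp.out hS hT).trans_lt (ENNReal.add_lt_top.2 ⟨?_, ?_⟩)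
    · exact (ENNReal.rpow_lt_top_iff_of_pos hp0).2 hS'
    · exact (ENNReal.rpow_lt_top_iff_of_pos hp0).2 hT'
  smul_mem' := by
    rintro c T ⟨hT, hT'⟩
    refine ⟨hT.smul c, ?_⟩
    rw [schattenTrace_smul hp.out c hT]
    exact ENNReal.mul_lt_top (ENNReal.rpow_lt_top_of_nonneg (by linarith [hp.out]) (by simp)) hT'

/-- The Schatten space `ℓ^p(H)` as a type of its own, so that it carries the norm `‖·‖_p` below
and not the operator norm. -/
def Schatten (p : ℝ) [Fact (1 ≤ p)] (H : Type u) [NormedAddCommGroup H]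
    [InnerProductSpace ℂ H] [CompleteSpace H] : Type u := schattenIdeal p H

namespace Schatten

variable {p : ℝ} [hp : Fact (1 ≤ p)]

instance : AddCommGroup (Schatten p H) := inferInstanceAs (AddCommGroup (schattenIdeal p H))

instance : Module ℂ (Schatten p H) := inferInstanceAs (Module ℂ (schattenIdeal p H))

/-- The inclusion of `ℓ^p(H)` into the bounded operators on `H`. -/
def toOperator : Schatten p H →ₗ[ℂ] (H →L[ℂ] H) := (schattenIdeal p H).subtype

theorem toOperator_injective : Function.Injective (toOperator : Schatten p H → (H →L[ℂ] H)) :=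
  Subtype.val_injective

theorem isCompactOperator (T : Schatten p H) : IsCompactOperator (toOperator T) := T.2.1

theorem schattenTrace_lt_top (T : Schatten p H) : schattenTrace p (toOperator T) < ∞ := T.2.2

/-- `‖T‖_p = (Trace ((T* T) ^ (p / 2))) ^ (1 / p)`. -/
instance : Norm (Schatten p H) where
  norm T := (schattenTrace p (toOperator T)).toReal ^ (1 / p)

theorem norm_def (T : Schatten p H) :
    ‖T‖ = (schattenTrace p (toOperator T)).toReal ^ (1 / p) := rfl

theorem normedSpaceCore : NormedSpace.Core ℂ (Schatten p H) where
  norm_nonneg T := Real.rpow_nonneg ENNReal.toReal_nonneg _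
  norm_smul c T := by
    have hp0 : p ≠ 0 := by linarith [hp.out]
    rw [norm_def, norm_def, map_smul, schattenTrace_smul hp.out c T.isCompactOperator,
      ENNReal.toReal_mul, ← ENNReal.toReal_rpow,
      Real.mul_rpow (by positivity) ENNReal.toReal_nonneg,
      ← Real.rpow_mul ENNReal.toReal_nonneg, mul_one_div_cancel hp0, Real.rpow_one, toReal_enorm]
  norm_triangle S T := by
    have hp0 : 0 ≤ 1 / p := by have := hp.out; positivity
    simp only [norm_def, ENNReal.toReal_rpow]
    have hS := (ENNReal.rpow_lt_top_of_nonneg hp0 S.schattenTrace_lt_top.ne).ne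
    have hT := (ENNReal.rpow_lt_top_of_nonneg hp0 T.schattenTrace_lt_top.ne).ne
    rw [← ENNReal.toReal_add hS hT, map_add]
    exact ENNReal.toReal_mono (ENNReal.add_ne_top.2 ⟨hS, hT⟩)
      (schattenTrace_add_le hp.out S.isCompactOperator T.isCompactOperator)
  norm_eq_zero_iff T := by
    have hp0 : 0 < p := by linarith [hp.out]
    rw [norm_def, Real.rpow_eq_zero ENNReal.toReal_nonneg (by positivity)]
    constructor
    · intro h
      have h1 := (ENNReal.toReal_eq_zero_iff _).1 h
      refine toOperator_injective ?_
      rw [map_zero]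
      exact eq_zero_of_schattenTrace_eq_zero hp0 T.isCompactOperator
        (h1.resolve_right T.schattenTrace_lt_top.ne)
    · rintro rfl
      rw [map_zero, schattenTrace_zero hp0, ENNReal.toReal_zero]

instance : NormedAddCommGroup (Schatten p H) := NormedAddCommGroup.ofCore normedSpaceCore

instance : NormedSpace ℂ (Schatten p H) := NormedSpace.ofCore normedSpaceCore

end Schatten

/-- The closure of the range of `|T| = (T* T) ^ (1 / 2)`. -/
def absRange (T : H →L[ℂ] H) : Submodule ℂ H :=
  (CFC.abs T).range.topologicalClosure

instance (T : H →L[ℂ] H) : CompleteSpace (absRange T) :=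
  (Submodule.isClosed_topologicalClosure _).completeSpace_coe

/-- `|T|` as a map into the closure of its range. -/
def absToRange (T : H →L[ℂ] H) : H →L[ℂ] absRange T :=
  (CFC.abs T).codRestrict (absRange T)
    fun x => Submodule.le_topologicalClosure _ (LinearMap.mem_range_self _ x)

/-- `sign T`, the partial isometry in the polar decomposition `T = sign T * |T|`: it sends `|T| x` to
`T x`, is extended by continuity to the closure of the range of `|T|`, and vanishes on the orthogonal
complement. It is the only operator `U` with `U * |T| = T` and `ker T ⊆ ker U`, see
`polarSign_mul_abs`, `polarSign_apply_eq_zero_iff` and `polarSign_unique`. -/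
def polarSign (T : H →L[ℂ] H) : H →L[ℂ] H :=
  (LinearMap.extendOfNorm (T : H →ₗ[ℂ] H) (absToRange T : H →ₗ[ℂ] absRange T)).comp
    (absRange T).orthogonalProjectionOnto

theorem norm_abs_apply (T : H →L[ℂ] H) (x : H) : ‖CFC.abs T x‖ = ‖T x‖ := by
  have hsa : IsSelfAdjoint (CFC.abs T) := IsSelfAdjoint.of_nonneg (CFC.abs_nonneg T)
  have h : ⟪CFC.abs T x, CFC.abs T x⟫_ℂ = ⟪T x, T x⟫_ℂ := by
    rw [← ContinuousLinearMap.adjoint_inner_right, ← ContinuousLinearMap.adjoint_inner_right T,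
      ← ContinuousLinearMap.star_eq_adjoint, ← ContinuousLinearMap.star_eq_adjoint,
      ← mul_apply_eq_comp, ← mul_apply_eq_comp, hsa.star_eq, CFC.abs_mul_abs]
  rw [norm_eq_sqrt_re_inner (𝕜 := ℂ), h, ← norm_eq_sqrt_re_inner]

theorem denseRange_absToRange (T : H →L[ℂ] H) :
    DenseRange (absToRange T : H →ₗ[ℂ] absRange T) := by
  intro y
  rw [closure_subtype]
  have h : (Subtype.val '' Set.range (absToRange T : H →ₗ[ℂ] absRange T) : Set H) =
      ((CFC.abs T).range : Set H) := by
    ext z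
    constructor
    · rintro ⟨_, ⟨x, rfl⟩, rfl⟩
      exact ⟨x, rfl⟩
    · rintro ⟨x, rfl⟩
      exact ⟨_, ⟨x, rfl⟩, rfl⟩
  rw [h]
  exact y.2

theorem extendOfNorm_absToRange (T : H →L[ℂ] H) (x : H) :
    LinearMap.extendOfNorm (T : H →ₗ[ℂ] H) (absToRange T : H →ₗ[ℂ] absRange T)
      (absToRange T x) = T x :=
  LinearMap.extendOfNorm_eq (denseRange_absToRange T)
    ⟨1, fun x => by rw [one_mul]; exact (norm_abs_apply T x).ge⟩ x

theorem polarSign_mul_abs (T : H →L[ℂ] H) : polarSign T * CFC.abs T = T := by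
  ext x
  have h : (absRange T).orthogonalProjectionOnto (CFC.abs T x) = absToRange T x :=
    Submodule.orthogonalProjectionOnto_mem_subspace_eq_self (absToRange T x)
  rw [mul_apply_eq_comp, polarSign, ContinuousLinearMap.comp_apply, h, extendOfNorm_absToRange]

theorem mem_absRange_orthogonal (T : H →L[ℂ] H) (x : H) : x ∈ (absRange T)ᗮ ↔ T x = 0 := by
  have hsa : IsSelfAdjoint (CFC.abs T) := IsSelfAdjoint.of_nonneg (CFC.abs_nonneg T)
  rw [absRange, Submodule.orthogonal_closure, ContinuousLinearMap.orthogonal_range,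
    hsa.adjoint_eq, ← norm_eq_zero (a := T x), ← norm_abs_apply, norm_eq_zero]
  exact LinearMap.mem_ker

theorem polarSign_apply_eq_zero_iff (T : H →L[ℂ] H) (x : H) : polarSign T x = 0 ↔ T x = 0 := by
  have hiso : ∀ y : absRange T, ‖LinearMap.extendOfNorm (T : H →ₗ[ℂ] H)
      (absToRange T : H →ₗ[ℂ] absRange T) y‖ = ‖y‖ := by
    refine (denseRange_absToRange T).induction ?_ (isClosed_eq (by fun_prop) (by fun_prop))
    rintro _ ⟨z, rfl⟩
    exact (congrArg norm (extendOfNorm_absToRange T z)).trans (norm_abs_apply T z).symm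
  rw [polarSign, ContinuousLinearMap.comp_apply, ← norm_eq_zero, hiso, norm_eq_zero,
    Submodule.orthogonalProjectionOnto_eq_zero_iff, mem_absRange_orthogonal]

theorem polarSign_unique {T U : H →L[ℂ] H} (h1 : U * CFC.abs T = T)
    (h2 : ∀ x, T x = 0 → U x = 0) : U = polarSign T := by
  have hK : ∀ y : absRange T, U y = polarSign T y := by
    refine (denseRange_absToRange T).induction ?_ (isClosed_eq (by fun_prop) (by fun_prop))
    rintro _ ⟨z, rfl⟩
    exact congrArg (fun V : H →L[ℂ] H => V z) (h1.trans (polarSign_mul_abs T).symm)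
  ext x
  obtain ⟨y, hy, z, hz, rfl⟩ := (absRange T).exists_add_mem_mem_orthogonal x
  have hz' := (mem_absRange_orthogonal T z).1 hz
  rw [map_add, map_add, hK ⟨y, hy⟩, h2 z hz', (polarSign_apply_eq_zero_iff T z).2 hz']

/-- The noncommutative Mazur map `T ↦ sign T * |T| ^ (p / q)`, on bounded operators. -/
def mazurMap (p q : ℝ) (T : H →L[ℂ] H) : H →L[ℂ] H := polarSign T * CFC.abs T ^ (p / q)

end

end NCMazur

/-! Write unit vectors of `ℓ^p` as `S = ∑ σ i ^ (1/p) ⟪g i, ·⟫ h i` and `T = ∑ τ j ^ (1/p) ⟪e j, ·⟫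
k j` with `∑ σ i = ∑ τ j = 1`. The Mazur map keeps `g`, `h` and `σ` and only replaces the exponent
`1/p` by `1/q`. Hence `M_{q,p}` inverts `M_{p,q}`, and only uniform continuity needs work.

The link between different exponents is the affinity `a(θ) = ∑ Re(⟪k j, h i⟫ ⟪g i, e j⟫) σ i ^ θ τ j
^ (1 - θ)`. For `r > 1`, `a(1/r)` is the value at `M_{p,r}(S)` of the norming functional of
`M_{p,r}(T)`. Three facts carry the proof. (1) Hölder: `1 - a(1/p) ≤ ‖T - S‖_p`
(`IsUnitSVD.one_sub_affinity_le`). (2) The deviations `1 - a(θ)`, `0 < θ < 1`, are all comparable,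
with constants depending only on the exponents (`IsSubstochastic.one_sub_affinity_le`). The weights
are dominated by a substochastic matrix, and gaps in weighted arithmetic-geometric mean inequalities
are comparable pointwise. (3) For `q ≥ 2`, Clarkson's inequality bounds `‖S - T‖_q ^ q` by a
multiple of `1 - a(1/q)` for unit vectors of `ℓ^q` (`IsUnitSVD.schattenTrace_sub_le`).

Together they give a Hölder modulus when `q ≥ 2`. For `1 < q < 2`, put `1/q = 1/2 + 1/s` and factor
`M_{p,q}(T) = M_{p,2}(T) |T|^{p/s}`. Both factors lie in classes with exponent at least `2`, and
Hölder's inequality for products recombines them. The moduli `|S|^{p/s}`, `|T|^{p/s}` have overlap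
weights `|⟪g i, e j⟫|²`, whose deviation is at most twice that of the original weights. -/

namespace NCMazur

noncomputable section

open scoped ENNReal InnerProductSpace

set_option linter.unusedSectionVars false

variable {H : Type u} [NormedAddCommGroup H] [InnerProductSpace ℂ H] [CompleteSpace H]

/-! ### Singular value decompositions and the operations that act on singular values -/

/-- A singular value decomposition `T = ∑ s i • ⟪g i, ·⟫ h i` along a Hilbert basis `g`. -/
structure IsSVD {ι : Type*} (T : H →L[ℂ] H) (g : HilbertBasis ι ℂ H) (s : ι → ℝ) (h : ι → H) :
    Prop where
  nonneg : ∀ i, 0 ≤ s i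
  apply_basis : ∀ i, T (g i) = (s i : ℂ) • h i
  eq_zero : ∀ i, s i = 0 → h i = 0
  orthonormal : Orthonormal ℂ (fun i : {i // s i ≠ 0} => h i)

theorem exists_isSVD {T : H →L[ℂ] H} (hT : IsCompactOperator T) :
    ∃ (ι : Type u) (g : HilbertBasis ι ℂ H) (s : ι → ℝ) (h : ι → H), IsSVD T g s h := by
  obtain ⟨ι, g, s, h, h1, h2, h3, h4, -⟩ := exists_singular_values hT
  exact ⟨ι, g, s, h, h1, h2, h3, h4⟩

theorem eq_of_basis {ι : Type*} (g : HilbertBasis ι ℂ H) {A B : H →L[ℂ] H}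
    (h : ∀ i, A (g i) = B (g i)) : A = B := by
  ext x
  have hA := (g.hasSum_repr x).mapL A
  have hB := (g.hasSum_repr x).mapL B
  simp only [map_smul, h] at hA hB
  exact hA.unique hB

theorem eq_of_inner_basis {ι : Type*} (g : HilbertBasis ι ℂ H) {x y : H}
    (h : ∀ i, ⟪g i, x⟫_ℂ = ⟪g i, y⟫_ℂ) : x = y := by
  apply g.repr.injective
  ext i
  rw [g.repr_apply_apply, g.repr_apply_apply, h]

theorem tsum_enorm_inner_sq_le_of_norm_le_one {ι : Type*} {v : ι → H} (hv : Orthonormal ℂ v)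
    {x : H} (hx : ‖x‖ ≤ 1) : ∑' i, ‖⟪v i, x⟫_ℂ‖ₑ ^ 2 ≤ 1 := by
  refine (tsum_enorm_inner_sq_le hv x).trans ?_
  have : ‖x‖ₑ ≤ 1 := by rw [← ofReal_norm]; exact ENNReal.ofReal_le_one.2 hx
  calc ‖x‖ₑ ^ 2 ≤ 1 ^ 2 := by gcongr
    _ = 1 := one_pow 2

namespace IsSVD

variable {ι : Type*} {T : H →L[ℂ] H} {g : HilbertBasis ι ℂ H} {s : ι → ℝ} {h : ι → H}

theorem inner_self_eq_one (hT : IsSVD T g s h) {i : ι} (hi : s i ≠ 0) : ⟪h i, h i⟫_ℂ = 1 := by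
  rw [inner_self_eq_norm_sq_to_K, hT.orthonormal.1 ⟨i, hi⟩]
  simp

theorem inner_eq_zero (hT : IsSVD T g s h) {i j : ι} (hij : i ≠ j) : ⟪h i, h j⟫_ℂ = 0 := by
  by_cases hi : s i = 0
  · simp [hT.eq_zero i hi]
  by_cases hj : s j = 0
  · simp [hT.eq_zero j hj]
  exact hT.orthonormal.2 (i := ⟨i, hi⟩) (j := ⟨j, hj⟩) (by simpa using hij)

theorem norm_le_one (hT : IsSVD T g s h) (i : ι) : ‖h i‖ ≤ 1 := by
  by_cases hi : s i = 0
  · simp [hT.eq_zero i hi]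
  · exact (hT.orthonormal.1 ⟨i, hi⟩).le

theorem tsum_enorm_inner_le_one (hT : IsSVD T g s h) {x : H} (hx : ‖x‖ ≤ 1) :
    ∑' i, ‖⟪h i, x⟫_ℂ‖ₑ ^ 2 ≤ 1 := by
  refine le_trans (le_of_eq ?_) (tsum_enorm_inner_sq_le_of_norm_le_one hT.orthonormal hx)
  refine (tsum_subtype_eq_of_support_subset (s := {i | s i ≠ 0})
    (f := fun i => ‖⟪h i, x⟫_ℂ‖ₑ ^ 2) ?_).symm
  intro i hi h0
  simp [hT.eq_zero i h0] at hi

theorem inner_apply_apply (hT : IsSVD T g s h) [DecidableEq ι] (i j : ι) :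
    ⟪T (g i), T (g j)⟫_ℂ = ((s j ^ 2 : ℝ) : ℂ) * (if i = j then 1 else 0) := by
  rw [hT.apply_basis, hT.apply_basis, inner_smul_left, inner_smul_right, Complex.conj_ofReal]
  by_cases hij : i = j
  · subst hij
    by_cases hi : s i = 0
    · simp [hi]
    · rw [hT.inner_self_eq_one hi]
      push_cast
      simp [sq]
  · simp [hT.inner_eq_zero hij, hij]

theorem star_mul_self_apply (hT : IsSVD T g s h) (i : ι) :
    (star T * T) (g i) = ((s i ^ 2 : ℝ) : ℂ) • g i := by
  classical
  refine eq_of_inner_basis g fun j => ?_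
  rw [mul_apply_eq_comp, ContinuousLinearMap.star_eq_adjoint,
    ContinuousLinearMap.adjoint_inner_right, hT.inner_apply_apply, inner_smul_right,
    orthonormal_iff_ite.1 g.orthonormal]

theorem abs_apply (hT : IsSVD T g s h) (i : ι) : CFC.abs T (g i) = (s i : ℂ) • g i := by
  rw [CFC.abs, CFC.sqrt_eq_rpow, rpow_apply_eigenvector (star_mul_self_nonneg T)
    (hT.star_mul_self_apply i) (g.orthonormal.ne_zero i) (by norm_num), ← Real.sqrt_eq_rpow,
    Real.sqrt_sq (hT.nonneg i)]

/-- The trace does not depend on the Hilbert basis, so any decomposition may be used, not just the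
one supplied by `exists_singular_values`. -/
theorem schattenTrace_eq (hT : IsSVD T g s h) {p : ℝ} (hp : 0 < p) :
    schattenTrace p T = ∑' i, ENNReal.ofReal (s i) ^ p := by
  rw [schattenTrace, traceNonneg_eq g CFC.rpow_nonneg]
  refine tsum_congr fun i => ?_
  rw [ContinuousLinearMap.reApplyInnerSelf_apply,
    rpow_apply_eigenvector (star_mul_self_nonneg T) (hT.star_mul_self_apply i)
      (g.orthonormal.ne_zero i) (by positivity), inner_smul_left,
    inner_self_eq_norm_sq_to_K, g.orthonormal.1 i,
    ENNReal.ofReal_rpow_of_nonneg (hT.nonneg i) hp.le, ← Real.rpow_natCast,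
    ← Real.rpow_mul (hT.nonneg i)]
  rw [show (((2 : ℕ) : ℝ) * (p / 2) : ℝ) = p by push_cast; ring]
  simp

theorem abs_rpow_apply (hT : IsSVD T g s h) {r : ℝ} (hr : 0 ≤ r) (i : ι) :
    (CFC.abs T ^ r) (g i) = ((s i ^ r : ℝ) : ℂ) • g i :=
  rpow_apply_eigenvector (CFC.abs_nonneg T) (hT.abs_apply i) (g.orthonormal.ne_zero i) hr

theorem polarSign_apply (hT : IsSVD T g s h) {i : ι} (hi : s i ≠ 0) :
    polarSign T (g i) = h i := by
  have h1 := congrArg (fun V : H →L[ℂ] H => V (g i)) (polarSign_mul_abs T)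
  simp only [mul_apply_eq_comp, hT.abs_apply, map_smul, hT.apply_basis] at h1
  exact smul_right_injective H (r := (s i : ℂ)) (by exact_mod_cast hi) h1

/-- The singular values of an operator may be changed, as long as none becomes zero. -/
theorem of_apply (hT : IsSVD T g s h) {A : H →L[ℂ] H} {a : ι → ℝ} (ha : ∀ i, 0 ≤ a i)
    (h0 : ∀ i, a i = 0 ↔ s i = 0) (hA : ∀ i, A (g i) = (a i : ℂ) • h i) : IsSVD A g a h where
  nonneg := ha
  apply_basis := hA
  eq_zero i hi := hT.eq_zero i ((h0 i).1 hi)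
  orthonormal := hT.orthonormal.comp (fun i : {i // a i ≠ 0} => ⟨i, fun h1 => i.2 ((h0 i).2 h1)⟩)
    (fun _ _ hij => Subtype.ext (congrArg (fun k : {i // s i ≠ 0} => k.1) hij))

theorem mazurMap (hT : IsSVD T g s h) {p q : ℝ} (hp : 0 < p) (hq : 0 < q) :
    IsSVD (mazurMap p q T) g (fun i => s i ^ (p / q)) h := by
  have hr : 0 < p / q := div_pos hp hq
  refine hT.of_apply (fun i => Real.rpow_nonneg (hT.nonneg i) _)
    (fun i => Real.rpow_eq_zero (hT.nonneg i) hr.ne') fun i => ?_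
  rw [NCMazur.mazurMap, mul_apply_eq_comp, hT.abs_rpow_apply hr.le, map_smul]
  by_cases hi : s i = 0
  · simp [hi, Real.zero_rpow hr.ne']
  · rw [hT.polarSign_apply hi]

/-- The left singular vectors of `|T| ^ r` are the `g i` themselves, replaced by `0` where `s i = 0`
because `IsSVD` demands it. -/
theorem abs_rpow (hT : IsSVD T g s h) {r : ℝ} (hr : 0 < r) :
    IsSVD (CFC.abs T ^ r) g (fun i => s i ^ r) (fun i => if s i = 0 then 0 else g i) where
  nonneg i := Real.rpow_nonneg (hT.nonneg i) _
  apply_basis i := by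
    rw [hT.abs_rpow_apply hr.le]
    split_ifs with hi
    · simp [hi, Real.zero_rpow hr.ne']
    · rfl
  eq_zero i hi := if_pos ((Real.rpow_eq_zero (hT.nonneg i) hr.ne').1 hi)
  orthonormal := by
    have h1 := g.orthonormal.comp (fun i : {i // s i ^ r ≠ 0} => (i : ι)) Subtype.val_injective
    convert h1 using 1
    ext1 i
    exact if_neg fun hi => i.2 ((Real.rpow_eq_zero (hT.nonneg i) hr.ne').2 hi)

/-- Expand `⟪x, T* T x⟫` in the eigenbasis `g` of `T* T`. The weight `s i` stays inside the inner
product so that the right side is a sum of coefficients along the orthogonal family `s i • g i`. -/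
theorem enorm_apply_sq (hT : IsSVD T g s h) (x : H) :
    ‖T x‖ₑ ^ 2 = ∑' i, ‖⟪(s i : ℂ) • g i, x⟫_ℂ‖ₑ ^ 2 := by
  have h1 := g.hasSum_inner_mul_inner x ((star T * T) x)
  have h2 : ∀ i, ⟪x, g i⟫_ℂ * ⟪g i, (star T * T) x⟫_ℂ =
      ((‖⟪(s i : ℂ) • g i, x⟫_ℂ‖ ^ 2 : ℝ) : ℂ) := by
    intro i
    rw [← (IsSelfAdjoint.star_mul_self T).adjoint_eq, ContinuousLinearMap.adjoint_inner_right,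
      hT.star_mul_self_apply, inner_smul_left, inner_smul_left, ← inner_conj_symm x, norm_mul,
      mul_pow]
    rw [Complex.conj_ofReal, RCLike.norm_conj, Complex.norm_real, Real.norm_eq_abs, sq_abs]
    push_cast
    rw [mul_left_comm, mul_comm _ ⟪g i, x⟫_ℂ, Complex.mul_conj, Complex.normSq_eq_norm_sq]
    push_cast
    rfl
  have h3 : ⟪x, (star T * T) x⟫_ℂ = ((‖T x‖ ^ 2 : ℝ) : ℂ) := by
    rw [mul_apply_eq_comp, ContinuousLinearMap.star_eq_adjoint,
      ContinuousLinearMap.adjoint_inner_right, inner_self_eq_norm_sq_to_K]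
    push_cast
    rfl
  simp only [h2, h3] at h1
  have h4 : HasSum (fun i => ‖⟪(s i : ℂ) • g i, x⟫_ℂ‖ ^ 2) (‖T x‖ ^ 2) :=
    Complex.hasSum_ofReal.1 h1
  have h5 := congrArg ENNReal.ofReal h4.tsum_eq
  rw [ENNReal.ofReal_tsum_of_nonneg (fun i => by positivity) h4.summable] at h5
  simpa only [ENNReal.ofReal_pow (norm_nonneg _), ofReal_norm] using h5.symm

theorem norm_le (hT : IsSVD T g s h) {ε : ℝ} (hε : 0 ≤ ε) (hs : ∀ i, s i ≤ ε) : ‖T‖ ≤ ε := by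
  refine ContinuousLinearMap.opNorm_le_bound _ hε fun x => ?_
  have h1 : ‖T x‖ₑ ^ 2 ≤ (ENNReal.ofReal ε * ‖x‖ₑ) ^ 2 := by
    rw [hT.enorm_apply_sq, mul_pow, enorm_sq_eq_tsum g x, ← ENNReal.tsum_mul_left]
    refine ENNReal.tsum_le_tsum fun i => ?_
    rw [inner_smul_left, enorm_mul, mul_pow]
    gcongr
    rw [← ofReal_norm, RCLike.norm_conj, Complex.norm_real, Real.norm_of_nonneg (hT.nonneg i)]
    exact ENNReal.ofReal_le_ofReal (hs i)
  have h2 := (ENNReal.pow_le_pow_left_iff (by norm_num)).1 h1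
  rw [← ofReal_norm, ← ofReal_norm, ← ENNReal.ofReal_mul hε] at h2
  exact (ENNReal.ofReal_le_ofReal_iff (by positivity)).1 h2

/-- Summability leaves only finitely many singular values above any threshold, so `T` is an
operator-norm limit of finite-rank truncations. This puts the images under the Mazur map into the
ideal. -/
theorem isCompactOperator (hT : IsSVD T g s h) {p : ℝ} (hp : 0 < p)
    (hs : ∑' i, ENNReal.ofReal (s i) ^ p ≠ ∞) : IsCompactOperator T := by
  classical
  have hmem : T ∈ closure {A : H →L[ℂ] H | IsCompactOperator A} := by
    rw [Metric.mem_closure_iff]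
    intro ε hε
    have h1 := ENNReal.tendsto_cofinite_zero_of_tsum_ne_top hs
    have h2 := h1.eventually_lt_const (u := ENNReal.ofReal (ε / 2) ^ p)
      (ENNReal.rpow_pos (ENNReal.ofReal_pos.2 (half_pos hε)) ENNReal.ofReal_ne_top)
    -- `F` is the finite set of indices with `s i ≥ ε / 2`; `D` below is the part of `T` carried by
    -- these indices, and `T - D` has all its singular values at most `ε / 2`.
    set F := (Filter.eventually_cofinite.1 h2).toFinset with hF
    have hlt : ∀ i ∉ F, s i ≤ ε / 2 := by
      intro i hi
      simp only [hF, Set.Finite.mem_toFinset, Set.mem_ofPred_eq, not_not] at hi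
      exact (ENNReal.ofReal_le_ofReal_iff (half_pos hε).le).1
        ((ENNReal.rpow_lt_rpow_iff hp).1 hi).le
    set D : H →L[ℂ] H := ∑ i ∈ F, (innerSL ℂ (g i)).smulRight (T (g i)) with hD
    have hDc : IsCompactOperator D := by
      have : ∀ i, IsCompactOperator ((innerSL ℂ (g i)).smulRight (T (g i))) := fun i =>
        (isCompactOperator_of_locallyCompactSpace_rng
          (ContinuousLinearMap.toSpanSingleton ℂ (T (g i)))).comp_clm (innerSL ℂ (g i))
      exact Submodule.sum_mem (compactOperator (RingHom.id ℂ) H H) fun i _ => this i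
    have hDg : ∀ j, D (g j) = if j ∈ F then T (g j) else 0 := by
      intro j
      simp [hD, orthonormal_iff_ite.1 g.orthonormal]
    have hsvd : IsSVD (T - D) g (fun i => if i ∈ F then 0 else s i)
        (fun i => if i ∈ F then 0 else h i) := by
      refine ⟨fun i => ?_, fun i => ?_, fun i hi => ?_, ?_⟩
      · split_ifs
        exacts [le_rfl, hT.nonneg i]
      · rw [sub_apply, hDg]
        split_ifs <;> simp [hT.apply_basis]
      · split_ifs with h5
        · rfl
        · exact hT.eq_zero i (by simpa [h5] using hi)
      · have h5 : ∀ i : {i // (if i ∈ F then 0 else s i) ≠ 0}, i.1 ∉ F ∧ s i ≠ 0 := by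
          rintro ⟨i, hi⟩
          by_cases h6 : i ∈ F
          · simp [h6] at hi
          · exact ⟨h6, by simpa [h6] using hi⟩
        have h6 := hT.orthonormal.comp
          (fun i : {i // (if i ∈ F then 0 else s i) ≠ 0} => ⟨i.1, (h5 i).2⟩)
          (fun _ _ hij => Subtype.ext (congrArg (fun k : {i // s i ≠ 0} => k.1) hij))
        convert h6 using 1
        ext1 i
        exact if_neg (h5 i).1
    refine ⟨D, hDc, ?_⟩
    rw [dist_eq_norm]
    refine (hsvd.norm_le (half_pos hε).le fun i => ?_).trans_lt (half_lt_self hε)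
    split_ifs with hi
    exacts [(half_pos hε).le, hlt i hi]
  rwa [(isClosed_setOfPred_isCompactOperator (σ₁₂ := RingHom.id ℂ)).closure_eq] at hmem

end IsSVD

/-! ### Hölder and Clarkson inequalities in the Schatten classes -/

/-- Jensen's inequality along each row, then interchange of the sums and the bound on the columns.
-/
theorem tsum_tsum_rpow_le {α β : Type*} {c : α → β → ℝ≥0∞} (hrow : ∀ k, ∑' i, c k i ≤ 1)
    (hcol : ∀ i, ∑' k, c k i ≤ 1) (a : β → ℝ≥0∞) {r : ℝ} (hr : 1 ≤ r) :
    ∑' k, (∑' i, c k i * a i) ^ r ≤ ∑' i, a i ^ r := by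
  calc ∑' k, (∑' i, c k i * a i) ^ r ≤ ∑' k, ∑' i, c k i * a i ^ r :=
        ENNReal.tsum_le_tsum fun k => tsum_weight_rpow_le (hrow k) hr
    _ = ∑' i, (∑' k, c k i) * a i ^ r := by
        rw [ENNReal.tsum_comm]
        simp_rw [ENNReal.tsum_mul_right]
    _ ≤ ∑' i, a i ^ r := by
        refine ENNReal.tsum_le_tsum fun i => ?_
        calc _ ≤ 1 * a i ^ r := by gcongr; exact hcol i
          _ = _ := one_mul _

theorem enorm_inner_symm {K : Type*} [NormedAddCommGroup K] [InnerProductSpace ℂ K] (x y : K) :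
    ‖⟪x, y⟫_ℂ‖ₑ = ‖⟪y, x⟫_ℂ‖ₑ := by
  rw [← ofReal_norm, ← ofReal_norm, norm_inner_symm]

/-- Coefficients of an orthogonal family with respect to an orthonormal one, measured in `ℓ^r`. -/
theorem tsum_inner_orthogonal_rpow_le {K : Type*} [NormedAddCommGroup K] [InnerProductSpace ℂ K]
    [CompleteSpace K] {α β : Type*} {x : β → K} (hx : ∀ i j, i ≠ j → ⟪x i, x j⟫_ℂ = 0)
    {f : α → K} (hf : Orthonormal ℂ f) {r : ℝ} (hr : 1 ≤ r) :
    ∑' k, (∑' i, ‖⟪x i, f k⟫_ℂ‖ₑ ^ 2) ^ r ≤ ∑' i, (‖x i‖ₑ ^ 2) ^ r := by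
  -- Normalised vectors, with `y i = 0` when `x i = 0` since `0⁻¹ = 0`. By Bessel's inequality in
  -- both directions the matrix `‖⟪y i, f k⟫‖²` is substochastic, and `tsum_tsum_rpow_le` applies.
  set y : β → K := fun i => ((‖x i‖⁻¹ : ℝ) : ℂ) • x i with hy
  have hxy : ∀ i, x i = ((‖x i‖ : ℝ) : ℂ) • y i := by
    intro i
    by_cases h0 : x i = 0
    · simp [h0]
    · rw [hy, smul_smul, ← Complex.ofReal_mul, mul_inv_cancel₀ (norm_ne_zero_iff.2 h0)]
      simp
  have hyn : ∀ i, x i ≠ 0 → ‖y i‖ = 1 := by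
    intro i h0
    rw [hy, norm_smul, Complex.norm_real, norm_inv, norm_norm,
      inv_mul_cancel₀ (norm_ne_zero_iff.2 h0)]
  have hyle : ∀ i, ‖y i‖ ≤ 1 := by
    intro i
    by_cases h0 : x i = 0
    · simp [hy, h0]
    · exact (hyn i h0).le
  have hyo : Orthonormal ℂ (fun i : {i // x i ≠ 0} => y i) := by
    refine ⟨fun i => hyn i i.2, fun i j hij => ?_⟩
    simp only [hy]
    rw [inner_smul_left, inner_smul_right, hx i j (fun h => hij (Subtype.ext h))]
    simp
  have key := tsum_tsum_rpow_le (c := fun k i => ‖⟪y i, f k⟫_ℂ‖ₑ ^ 2) (fun k => ?_) (fun i => ?_)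
    (fun i => ‖x i‖ₑ ^ 2) hr
  · refine le_trans (le_of_eq ?_) key
    refine tsum_congr fun k => congrArg (· ^ r) (tsum_congr fun i => ?_)
    have h1 : ‖((‖x i‖ : ℝ) : ℂ)‖ₑ = ‖x i‖ₑ := by
      rw [← ofReal_norm, Complex.norm_real, norm_norm, ofReal_norm]
    conv_lhs => rw [hxy i]
    rw [inner_smul_left, Complex.conj_ofReal, enorm_mul, mul_pow, mul_comm, h1]
  · refine le_trans (le_of_eq ?_)
      (tsum_enorm_inner_sq_le_of_norm_le_one hyo (hf.1 k).le)
    refine (tsum_subtype_eq_of_support_subset (s := {i | x i ≠ 0})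
      (f := fun i => ‖⟪y i, f k⟫_ℂ‖ₑ ^ 2) ?_).symm
    intro i hi h0
    simp [hy, h0] at hi
  · simp_rw [enorm_inner_symm (y i)]
    exact tsum_enorm_inner_sq_le_of_norm_le_one hf (hyle i)

/-- `‖T e‖²` is the sum of squared coefficients of `e` along the orthogonal family `s i • g i`. The
condition `2 ≤ q` makes the exponent `q / 2` at least `1`, as Jensen's inequality requires. -/
theorem tsum_enorm_apply_rpow_le {q : ℝ} (hq : 2 ≤ q) {T : H →L[ℂ] H} (hT : IsCompactOperator T)
    {κ : Type*} {e : κ → H} (he : Orthonormal ℂ e) :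
    ∑' k, ‖T (e k)‖ₑ ^ q ≤ schattenTrace q T := by
  obtain ⟨ι, g, s, h, hs⟩ := exists_isSVD hT
  have h1 := tsum_inner_orthogonal_rpow_le (x := fun i => (s i : ℂ) • g i)
    (fun i j hij => by
      rw [inner_smul_left, inner_smul_right, g.orthonormal.2 hij, mul_zero, mul_zero])
    he (r := q / 2) (by linarith)
  simp_rw [← hs.enorm_apply_sq] at h1
  have h2 : ∀ x : ℝ≥0∞, (x ^ 2) ^ (q / 2) = x ^ q := fun x => by
    rw [← ENNReal.rpow_natCast, ← ENNReal.rpow_mul]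
    congr 1
    push_cast
    ring
  simp_rw [h2] at h1
  rw [hs.schattenTrace_eq (by linarith)]
  refine h1.trans (le_of_eq (tsum_congr fun i => ?_))
  rw [enorm_smul, ← ofReal_norm (g i), g.orthonormal.1 i, ← ofReal_norm, Complex.norm_real,
    Real.norm_of_nonneg (hs.nonneg i)]
  simp

/-- The vectors `T (g i)` are orthogonal and `‖T* f‖² = ∑ ‖⟪T (g i), f⟫‖²`. This gives the
Hilbert-Schmidt bound on `T*` without computing the Schatten trace of `T*`. -/
theorem tsum_enorm_star_apply_sq_le {T : H →L[ℂ] H} (hT : IsCompactOperator T)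
    {κ : Type*} {f : κ → H} (hf : Orthonormal ℂ f) :
    ∑' k, ‖star T (f k)‖ₑ ^ 2 ≤ schattenTrace 2 T := by
  obtain ⟨ι, g, s, h, hs⟩ := exists_isSVD hT
  have h1 := tsum_inner_orthogonal_rpow_le (x := fun i => T (g i))
    (fun i j hij => by
      classical
      rw [hs.inner_apply_apply, if_neg hij, mul_zero])
    hf (r := 1) le_rfl
  simp only [ENNReal.rpow_one] at h1
  refine le_trans (le_of_eq (tsum_congr fun k => ?_))
    (h1.trans (le_trans (le_of_eq (tsum_congr fun i => ?_))
      (tsum_enorm_apply_rpow_le le_rfl hT g.orthonormal)))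
  · rw [enorm_sq_eq_tsum g]
    refine tsum_congr fun i => ?_
    rw [ContinuousLinearMap.star_eq_adjoint, ContinuousLinearMap.adjoint_inner_right]
  · rw [← ENNReal.rpow_natCast]
    norm_num

theorem enorm_inner_le (x y : H) : ‖⟪x, y⟫_ℂ‖ₑ ≤ ‖x‖ₑ * ‖y‖ₑ := by
  rw [← ofReal_norm, ← ofReal_norm, ← ofReal_norm, ← ENNReal.ofReal_mul (norm_nonneg _)]
  exact ENNReal.ofReal_le_ofReal (norm_inner_le_norm x y)

theorem tsum_mul_le_Lp_mul_Lq {ι : Type*} (a b : ι → ℝ≥0∞) {p q : ℝ} (hpq : p.HolderConjugate q) :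
    ∑' i, a i * b i ≤ (∑' i, a i ^ p) ^ (1 / p) * (∑' i, b i ^ q) ^ (1 / q) := by
  rw [ENNReal.tsum_eq_iSup_sum]
  refine iSup_le fun t => (ENNReal.inner_le_Lp_mul_Lq t a b hpq).trans ?_
  have hp := hpq.pos
  have hq := hpq.symm.pos
  gcongr <;> exact ENNReal.sum_le_tsum t

/-- Hölder's inequality `‖A B‖_q ≤ ‖A‖_2 ‖B‖_s` for `1 / q = 1 / 2 + 1 / s` with `2 ≤ s`. -/
theorem schattenTrace_mul_le {q s : ℝ} (hq : 1 ≤ q) (hs : 2 ≤ s) (hqs : 1 / q = 1 / 2 + 1 / s)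
    {A B : H →L[ℂ] H} (hA : IsCompactOperator A) (hB : IsCompactOperator B) :
    schattenTrace q (A * B) ^ (1 / q) ≤
      schattenTrace 2 A ^ (1 / 2 : ℝ) * schattenTrace s B ^ (1 / s) := by
  have hq0 : 0 < q := by linarith
  have hs0 : 0 < s := by linarith
  obtain ⟨κ, e, f, he, hf, h⟩ := exists_tsum_eq_schattenTrace (T := A * B) hq (hA.comp_clm B)
  have hAB : schattenTrace q (A * B) = ∑' k, ‖⟪f k, A (B (e k))⟫_ℂ‖ₑ ^ q := h
  have hconj : (2 / q).HolderConjugate (s / q) := by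
    rw [Real.holderConjugate_iff]
    constructor
    · rw [lt_div_iff₀ hq0]
      have : 1 / 2 < 1 / q := by rw [hqs]; linarith [one_div_pos.2 hs0]
      rw [one_div_lt_one_div (by norm_num) hq0] at this
      linarith
    · rw [inv_div, inv_div]
      have : q * (1 / q) = q * (1 / 2 + 1 / s) := by rw [hqs]
      rw [mul_one_div_cancel hq0.ne'] at this
      rw [this]
      ring
  have h1 : schattenTrace q (A * B) ≤
      schattenTrace 2 A ^ (q / 2) * schattenTrace s B ^ (q / s) := by
    rw [hAB]
    -- Moving `A` to the left separates the factors: `|⟪f, A B e⟫| ≤ ‖A* f‖ ‖B e‖`. Scalar Hölder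
    -- with the conjugate exponents `2 / q` and `s / q` finishes.
    calc ∑' k, ‖⟪f k, A (B (e k))⟫_ℂ‖ₑ ^ q
        ≤ ∑' k, ‖star A (f k)‖ₑ ^ q * ‖B (e k)‖ₑ ^ q := by
          refine ENNReal.tsum_le_tsum fun k => ?_
          rw [← ENNReal.mul_rpow_of_nonneg _ _ hq0.le, ← ContinuousLinearMap.adjoint_inner_left,
            ← ContinuousLinearMap.star_eq_adjoint]
          exact ENNReal.rpow_le_rpow (enorm_inner_le _ _) hq0.le
      _ ≤ _ := tsum_mul_le_Lp_mul_Lq _ _ hconj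
      _ ≤ _ := by
          simp_rw [← ENNReal.rpow_mul, mul_div_cancel₀ _ hq0.ne', one_div_div]
          gcongr
          · have := tsum_enorm_star_apply_sq_le hA hf
            simp_rw [← ENNReal.rpow_natCast] at this
            exact_mod_cast this
          · exact tsum_enorm_apply_rpow_le hs hB he
  calc _ ≤ (schattenTrace 2 A ^ (q / 2) * schattenTrace s B ^ (q / s)) ^ (1 / q) := by gcongr
    _ = _ := by
      rw [ENNReal.mul_rpow_of_nonneg _ _ (by positivity), ← ENNReal.rpow_mul, ← ENNReal.rpow_mul]
      congr 2 <;> field_simp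

theorem enorm_sq_add_enorm_sq (x y : H) :
    ‖x + y‖ₑ ^ 2 + ‖x - y‖ₑ ^ 2 = 2 * (‖x‖ₑ ^ 2 + ‖y‖ₑ ^ 2) := by
  have h := congrArg ENNReal.ofReal (parallelogram_law_with_norm ℂ x y)
  rw [ENNReal.ofReal_add (by positivity) (by positivity), ENNReal.ofReal_mul (by norm_num),
    ENNReal.ofReal_add (by positivity) (by positivity)] at h
  simpa only [← sq, ENNReal.ofReal_pow (norm_nonneg _), ofReal_norm, ENNReal.ofReal_ofNat] using h

/-- Clarkson's inequality in the Schatten classes, for `2 ≤ q`. -/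
theorem schattenTrace_add_sub_le {q : ℝ} (hq : 2 ≤ q) {X Y : H →L[ℂ] H}
    (hX : IsCompactOperator X) (hY : IsCompactOperator Y) :
    schattenTrace q (X + Y) + schattenTrace q (X - Y) ≤
      2 ^ (q - 1) * (schattenTrace q X + schattenTrace q Y) := by
  have hq0 : 0 < q := by linarith
  set P := X + Y with hP
  set Q := X - Y with hQ
  have hPc : IsCompactOperator P := hX.add hY
  have hQc : IsCompactOperator Q := hX.sub hY
  obtain ⟨ι, c, l, hl, hc⟩ := exists_eigenbasis (A := star P * P + star Q * Q)
    (add_nonneg (star_mul_self_nonneg P) (star_mul_self_nonneg Q))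
    ((hPc.clm_comp (star P)).add (hQc.clm_comp (star Q)))
  obtain ⟨κ₁, e₁, f₁, he₁, hf₁, h₁⟩ := exists_tsum_eq_schattenTrace (by linarith : 1 ≤ q) hPc
  obtain ⟨κ₂, e₂, f₂, he₂, hf₂, h₂⟩ := exists_tsum_eq_schattenTrace (by linarith : 1 ≤ q) hQc
  -- Stack `P` and `Q` into one operator `z ↦ (P z, Q z)` from `H` to the Hilbert sum of two copies
  -- of `H`. Since `c` diagonalises `P* P + Q* Q`, the images `x m` of the basis vectors are
  -- orthogonal; `F` joins the left singular vectors of `P` and of `Q`.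
  set x : ι → WithLp 2 (H × H) := fun m => WithLp.toLp 2 (P (c m), Q (c m)) with hx
  set F : κ₁ ⊕ κ₂ → WithLp 2 (H × H) :=
    Sum.elim (fun k => WithLp.toLp 2 (f₁ k, 0)) (fun k => WithLp.toLp 2 (0, f₂ k)) with hF
  have hFo : Orthonormal ℂ F := by
    classical
    rw [orthonormal_iff_ite]
    rintro (i | i) (j | j)
    · simp [hF, WithLp.prod_inner_apply, orthonormal_iff_ite.1 hf₁]
    · simp [hF, WithLp.prod_inner_apply]
    · simp [hF, WithLp.prod_inner_apply]
    · simp [hF, WithLp.prod_inner_apply, orthonormal_iff_ite.1 hf₂]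
  have hxo : ∀ i j, i ≠ j → ⟪x i, x j⟫_ℂ = 0 := by
    intro i j hij
    have h3 : ⟪x i, x j⟫_ℂ = ⟪c i, (star P * P + star Q * Q) (c j)⟫_ℂ := by
      rw [add_apply, inner_add_right, mul_apply_eq_comp, mul_apply_eq_comp,
        ContinuousLinearMap.star_eq_adjoint, ContinuousLinearMap.star_eq_adjoint,
        ContinuousLinearMap.adjoint_inner_right, ContinuousLinearMap.adjoint_inner_right]
      simp [hx, WithLp.prod_inner_apply]
    rw [h3, hc, inner_smul_right, c.orthonormal.2 hij, mul_zero]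
  have hpow : ∀ z : ℝ≥0∞, (z ^ 2) ^ (q / 2) = z ^ q := fun z => by
    rw [← ENNReal.rpow_natCast, ← ENNReal.rpow_mul]
    congr 1
    push_cast
    ring
  have key := tsum_inner_orthogonal_rpow_le hxo hFo (r := q / 2) (by linarith)
  rw [ENNReal.summable.tsum_sum ENNReal.summable] at key
  -- From `|⟪f, R e⟫| ≤ ‖R* f‖`, with `‖R* f‖²` expanded in `c`. The right singular vectors drop
  -- out, and `P` and `Q` are both seen through the common basis `c`.
  have hle : ∀ (R : H →L[ℂ] H) (e f : H), ‖e‖ = 1 →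
      ‖⟪f, R e⟫_ℂ‖ₑ ^ q ≤ (∑' m, ‖⟪R (c m), f⟫_ℂ‖ₑ ^ 2) ^ (q / 2) := by
    intro R e f he
    have h3 : ∑' m, ‖⟪R (c m), f⟫_ℂ‖ₑ ^ 2 = ‖star R f‖ₑ ^ 2 := by
      rw [enorm_sq_eq_tsum c]
      refine tsum_congr fun m => ?_
      rw [ContinuousLinearMap.star_eq_adjoint, ContinuousLinearMap.adjoint_inner_right]
    rw [h3, hpow]
    refine ENNReal.rpow_le_rpow ?_ hq0.le
    rw [← ContinuousLinearMap.adjoint_inner_left, ← ContinuousLinearMap.star_eq_adjoint]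
    refine (enorm_inner_le _ _).trans ?_
    rw [← ofReal_norm e, he]
    simp
  calc schattenTrace q P + schattenTrace q Q
      ≤ ∑' k, (∑' i, ‖⟪x i, F (Sum.inl k)⟫_ℂ‖ₑ ^ 2) ^ (q / 2) +
          ∑' k, (∑' i, ‖⟪x i, F (Sum.inr k)⟫_ℂ‖ₑ ^ 2) ^ (q / 2) := by
        rw [h₁, h₂]
        gcongr with k k
        · refine (hle P (e₁ k) (f₁ k) (he₁.1 k)).trans (le_of_eq ?_)
          simp [hx, hF, WithLp.prod_inner_apply]
        · refine (hle Q (e₂ k) (f₂ k) (he₂.1 k)).trans (le_of_eq ?_)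
          simp [hx, hF, WithLp.prod_inner_apply]
    _ ≤ _ := key
    _ ≤ ∑' m, 2 ^ (q - 1) * (‖X (c m)‖ₑ ^ q + ‖Y (c m)‖ₑ ^ q) := by
        refine ENNReal.tsum_le_tsum fun m => ?_
        have h3 : ‖x m‖ₑ ^ 2 = 2 * (‖X (c m)‖ₑ ^ 2 + ‖Y (c m)‖ₑ ^ 2) := by
          rw [← enorm_sq_add_enorm_sq]
          have h4 := congrArg ENNReal.ofReal (WithLp.prod_norm_sq_eq_of_L2 (x m))
          rw [ENNReal.ofReal_add (by positivity) (by positivity)] at h4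
          simp only [ENNReal.ofReal_pow (norm_nonneg _), ofReal_norm] at h4
          exact h4
        rw [h3, ENNReal.mul_rpow_of_nonneg _ _ (by positivity)]
        -- The parallelogram law contributes `2 ^ (q / 2)` and convexity of `z ↦ z ^ (q / 2)`
        -- contributes `2 ^ (q / 2 - 1)`, with product `2 ^ (q - 1)`.
        calc _ ≤ (2 : ℝ≥0∞) ^ (q / 2) * (2 ^ (q / 2 - 1) *
              ((‖X (c m)‖ₑ ^ 2) ^ (q / 2) + (‖Y (c m)‖ₑ ^ 2) ^ (q / 2))) := by
              gcongr
              exact ENNReal.rpow_add_le_mul_rpow_add_rpow _ _ (by linarith)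
          _ = _ := by
              rw [hpow, hpow, ← mul_assoc, ← ENNReal.rpow_add _ _ (by simp) (by simp)]
              congr 2
              ring
    _ ≤ _ := by
        rw [ENNReal.tsum_mul_left, ENNReal.tsum_add]
        gcongr
        · exact tsum_enorm_apply_rpow_le hq hX c.orthonormal
        · exact tsum_enorm_apply_rpow_le hq hY c.orthonormal

/-! ### Comparison of gaps in the weighted arithmetic-geometric mean inequality -/

/-- The constant comparing the gaps in the inequalities of weighted means with weights `θ`, `η`. -/
def gapConst (θ η : ℝ) : ℝ := 2 * max (θ / η) ((1 - θ) / (1 - η))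

/-- The mean `σ ^ η τ ^ (1 - η)` is itself a geometric mean of `σ`, `τ` and `σ ^ θ τ ^ (1 - θ)`,
with weights `η - θ / C`, `(1 - η) - (1 - θ) / C` and `1 / C`. The hypotheses on `C` make these
weights nonnegative, and the three-point mean inequality, multiplied by `C`, is the claim. -/
theorem mean_sub_le {θ η σ τ : ℝ} (hθ : 0 < θ) (hθ1 : θ < 1)
    (hσ : 0 ≤ σ) (hτ : 0 ≤ τ) {C : ℝ} (h1 : θ ≤ C * η) (h2 : 1 - θ ≤ C * (1 - η)) :
    θ * σ + (1 - θ) * τ - σ ^ θ * τ ^ (1 - θ) ≤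
      C * (η * σ + (1 - η) * τ - σ ^ η * τ ^ (1 - η)) := by
  have hC : 0 < C := by linarith
  have hw₁ : 0 ≤ η - θ / C := by
    rw [sub_nonneg, div_le_iff₀ hC]; linarith
  have hw₂ : 0 ≤ (1 - η) - (1 - θ) / C := by
    rw [sub_nonneg, div_le_iff₀ hC]; linarith
  have hst : 0 ≤ σ ^ θ * τ ^ (1 - θ) := by positivity
  have key := Real.geom_mean_le_arith_mean3_weighted (p₁ := σ) (p₂ := τ)
    (p₃ := σ ^ θ * τ ^ (1 - θ)) hw₁ hw₂ (one_div_pos.2 hC).le hσ hτ hst (by field_simp; ring)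
  have hl : σ ^ (η - θ / C) * τ ^ ((1 - η) - (1 - θ) / C) * (σ ^ θ * τ ^ (1 - θ)) ^ (1 / C) =
      σ ^ η * τ ^ (1 - η) := by
    rw [Real.mul_rpow (by positivity) (by positivity), ← Real.rpow_mul hσ, ← Real.rpow_mul hτ,
      mul_one_div, mul_one_div, mul_mul_mul_comm,
      ← Real.rpow_add_of_nonneg hσ hw₁ (by positivity),
      ← Real.rpow_add_of_nonneg hτ hw₂ (div_nonneg (by linarith) hC.le)]
    congr 2 <;> ring
  rw [hl] at key
  have h3 := mul_le_mul_of_nonneg_left key hC.le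
  have h4 : C * ((η - θ / C) * σ + ((1 - η) - (1 - θ) / C) * τ +
      1 / C * (σ ^ θ * τ ^ (1 - θ))) =
      C * (η * σ + (1 - η) * τ) - (θ * σ + (1 - θ) * τ) + σ ^ θ * τ ^ (1 - θ) := by
    field_simp
    ring
  rw [h4] at h3
  linarith

theorem rpow_mul_rpow_le {θ σ τ : ℝ} (hθ : 0 < θ) (hθ1 : θ < 1) (hσ : 0 ≤ σ) (hτ : 0 ≤ τ) :
    σ ^ θ * τ ^ (1 - θ) ≤ θ * σ + (1 - θ) * τ :=
  Real.geom_mean_le_arith_mean2_weighted hθ.le (by linarith) hσ hτ (by ring)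

theorem le_gapConst {θ η : ℝ} (hη : 0 < η) (hη1 : η < 1) :
    2 * θ ≤ gapConst θ η * η ∧ 2 * (1 - θ) ≤ gapConst θ η * (1 - η) := by
  have h1 := le_max_left (θ / η) ((1 - θ) / (1 - η))
  have h2 := le_max_right (θ / η) ((1 - θ) / (1 - η))
  rw [div_le_iff₀ hη] at h1
  rw [div_le_iff₀ (by linarith)] at h2
  rw [gapConst]
  constructor <;> linarith

theorem gapConst_nonneg {θ η : ℝ} (hθ : 0 < θ) (hη : 0 < η) : 0 ≤ gapConst θ η := by
  have h := le_max_left (θ / η) ((1 - θ) / (1 - η))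
  have : 0 < θ / η := by positivity
  rw [gapConst]
  linarith

/-- Both sides are affine in `w`, so it suffices to combine the extreme cases `w = c` and `w = -c`
with coefficients `(c + w) / 2` and `(c - w) / 2` (after division by `c`). The signs of `w` are
arbitrary, hence the second case. -/
theorem weighted_mean_sub_le {θ η σ τ c w : ℝ} (hθ : 0 < θ) (hθ1 : θ < 1) (hη : 0 < η)
    (hη1 : η < 1) (hσ : 0 ≤ σ) (hτ : 0 ≤ τ) (hw : |w| ≤ c) :
    c * (θ * σ + (1 - θ) * τ) - w * (σ ^ θ * τ ^ (1 - θ)) ≤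
      gapConst θ η * (c * (η * σ + (1 - η) * τ) - w * (σ ^ η * τ ^ (1 - η))) := by
  obtain ⟨hw1, hw2⟩ := abs_le.1 hw
  obtain ⟨hC1, hC2⟩ := le_gapConst (θ := θ) hη hη1
  have hC := gapConst_nonneg hθ hη
  have h1 := mean_sub_le hθ hθ1 (η := η) hσ hτ (C := gapConst θ η) (by linarith) (by linarith)
  -- The case `w = -c`. The left side is at most twice the arithmetic mean, which is why `gapConst`
  -- carries a factor `2`.
  have h2 : θ * σ + (1 - θ) * τ + σ ^ θ * τ ^ (1 - θ) ≤
      gapConst θ η * (η * σ + (1 - η) * τ + σ ^ η * τ ^ (1 - η)) := by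
    have h3 := rpow_mul_rpow_le hθ hθ1 hσ hτ
    have h4 : 0 ≤ gapConst θ η * (σ ^ η * τ ^ (1 - η)) := by positivity
    have h5 := mul_le_mul_of_nonneg_right hC1 hσ
    have h6 := mul_le_mul_of_nonneg_right hC2 hτ
    linarith
  have h3 := mul_le_mul_of_nonneg_left h1 (by linarith : 0 ≤ (c + w) / 2)
  have h4 := mul_le_mul_of_nonneg_left h2 (by linarith : 0 ≤ (c - w) / 2)
  linarith

/-! ### Substochastic matrices and affinities -/

/-- A matrix with nonnegative entries whose row and column sums are at most `1`. -/
structure IsSubstochastic {ι κ : Type*} (c : ι × κ → ℝ) : Prop where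
  nonneg : ∀ x, 0 ≤ c x
  row : ∀ i (F : Finset κ), ∑ j ∈ F, c (i, j) ≤ 1
  col : ∀ j (F : Finset ι), ∑ i ∈ F, c (i, j) ≤ 1

namespace IsSubstochastic

variable {ι κ : Type*} {c d : ι × κ → ℝ}

theorem half_add (hc : IsSubstochastic c) (hd : IsSubstochastic d) :
    IsSubstochastic (fun x => (c x + d x) / 2) where
  nonneg x := by have := hc.nonneg x; have := hd.nonneg x; positivity
  row i F := by
    rw [← Finset.sum_div, Finset.sum_add_distrib]
    linarith [hc.row i F, hd.row i F]
  col j F := by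
    rw [← Finset.sum_div, Finset.sum_add_distrib]
    linarith [hc.col j F, hd.col j F]

theorem sum_mul_fst_le (hc : IsSubstochastic c) {σ : ι → ℝ} (hσ : ∀ i, 0 ≤ σ i)
    (hσ1 : HasSum σ 1) (F : Finset (ι × κ)) : ∑ x ∈ F, c x * σ x.1 ≤ 1 := by
  classical
  calc ∑ x ∈ F, c x * σ x.1 ≤ ∑ x ∈ F.image Prod.fst ×ˢ F.image Prod.snd, c x * σ x.1 :=
        Finset.sum_le_sum_of_subset_of_nonneg Finset.subset_product
          fun x _ _ => mul_nonneg (hc.nonneg x) (hσ _)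
    _ = ∑ i ∈ F.image Prod.fst, (∑ j ∈ F.image Prod.snd, c (i, j)) * σ i := by
        rw [Finset.sum_product]
        simp_rw [Finset.sum_mul]
    _ ≤ ∑ i ∈ F.image Prod.fst, σ i := by
        refine Finset.sum_le_sum fun i _ => ?_
        have := mul_le_mul_of_nonneg_right (hc.row i (F.image Prod.snd)) (hσ i)
        linarith
    _ ≤ 1 := sum_le_hasSum _ (fun i _ => hσ i) hσ1

theorem sum_mul_snd_le (hc : IsSubstochastic c) {τ : κ → ℝ} (hτ : ∀ j, 0 ≤ τ j)
    (hτ1 : HasSum τ 1) (F : Finset (ι × κ)) : ∑ x ∈ F, c x * τ x.2 ≤ 1 := by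
  have hc' : IsSubstochastic (fun x : κ × ι => c x.swap) :=
    ⟨fun x => hc.nonneg _, fun j F => hc.col j F, fun i F => hc.row i F⟩
  have h := hc'.sum_mul_fst_le hτ hτ1 (F.map (Equiv.prodComm ι κ).toEmbedding)
  rwa [Finset.sum_map] at h

variable {σ : ι → ℝ} {τ : κ → ℝ}

theorem summable_fst (hc : IsSubstochastic c) (hσ : ∀ i, 0 ≤ σ i) (hσ1 : HasSum σ 1) :
    Summable fun x : ι × κ => c x * σ x.1 :=
  summable_of_sum_le (fun x => mul_nonneg (hc.nonneg x) (hσ _)) (hc.sum_mul_fst_le hσ hσ1)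

theorem summable_snd (hc : IsSubstochastic c) (hτ : ∀ j, 0 ≤ τ j) (hτ1 : HasSum τ 1) :
    Summable fun x : ι × κ => c x * τ x.2 :=
  summable_of_sum_le (fun x => mul_nonneg (hc.nonneg x) (hτ _)) (hc.sum_mul_snd_le hτ hτ1)

theorem summable_mean (hc : IsSubstochastic c) (hσ : ∀ i, 0 ≤ σ i) (hτ : ∀ j, 0 ≤ τ j)
    (hσ1 : HasSum σ 1) (hτ1 : HasSum τ 1) (θ : ℝ) :
    Summable fun x : ι × κ => c x * (θ * σ x.1 + (1 - θ) * τ x.2) := by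
  refine (((hc.summable_fst hσ hσ1).mul_left θ).add
    ((hc.summable_snd hτ hτ1).mul_left (1 - θ))).congr fun x => ?_
  ring

theorem tsum_mean (hc : IsSubstochastic c) (hσ : ∀ i, 0 ≤ σ i) (hτ : ∀ j, 0 ≤ τ j)
    (hσ1 : HasSum σ 1) (hτ1 : HasSum τ 1) (θ : ℝ) :
    ∑' x : ι × κ, c x * (θ * σ x.1 + (1 - θ) * τ x.2) =
      θ * ∑' x : ι × κ, c x * σ x.1 + (1 - θ) * ∑' x : ι × κ, c x * τ x.2 := by
  rw [← tsum_mul_left, ← tsum_mul_left, ← Summable.tsum_add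
    ((hc.summable_fst hσ hσ1).mul_left θ) ((hc.summable_snd hτ hτ1).mul_left (1 - θ))]
  exact tsum_congr fun x => by ring

end IsSubstochastic

/-- `∑ w (i, j) * σ i ^ θ * τ j ^ (1 - θ)`. -/
def affinity {ι κ : Type*} (w : ι × κ → ℝ) (σ : ι → ℝ) (τ : κ → ℝ) (θ : ℝ) : ℝ :=
  ∑' x : ι × κ, w x * (σ x.1 ^ θ * τ x.2 ^ (1 - θ))

namespace IsSubstochastic

variable {ι κ : Type*} {c d w : ι × κ → ℝ} {σ : ι → ℝ} {τ : κ → ℝ} {θ η : ℝ}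

theorem abs_affinity_term_le (hw : ∀ x, |w x| ≤ c x) (hσ : ∀ i, 0 ≤ σ i)
    (hτ : ∀ j, 0 ≤ τ j) (hθ : 0 < θ) (hθ1 : θ < 1) (x : ι × κ) :
    |w x * (σ x.1 ^ θ * τ x.2 ^ (1 - θ))| ≤ c x * (θ * σ x.1 + (1 - θ) * τ x.2) := by
  have h1 := hσ x.1
  have h2 := hτ x.2
  rw [abs_mul, abs_of_nonneg (a := σ x.1 ^ θ * τ x.2 ^ (1 - θ)) (by positivity)]
  exact mul_le_mul (hw x) (rpow_mul_rpow_le hθ hθ1 h1 h2) (by positivity)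
    ((abs_nonneg _).trans (hw x))

theorem summable_affinity (hc : IsSubstochastic c) (hw : ∀ x, |w x| ≤ c x) (hσ : ∀ i, 0 ≤ σ i)
    (hτ : ∀ j, 0 ≤ τ j) (hσ1 : HasSum σ 1) (hτ1 : HasSum τ 1) (hθ : 0 < θ) (hθ1 : θ < 1) :
    Summable fun x : ι × κ => w x * (σ x.1 ^ θ * τ x.2 ^ (1 - θ)) :=
  (hc.summable_mean hσ hτ hσ1 hτ1 θ).of_norm_bounded
    fun x => abs_affinity_term_le hw hσ hτ hθ hθ1 x

theorem abs_affinity_le_one (hc : IsSubstochastic c) (hw : ∀ x, |w x| ≤ c x)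
    (hσ : ∀ i, 0 ≤ σ i) (hτ : ∀ j, 0 ≤ τ j) (hσ1 : HasSum σ 1) (hτ1 : HasSum τ 1)
    (hθ : 0 < θ) (hθ1 : θ < 1) : |affinity w σ τ θ| ≤ 1 := by
  have h1 : |affinity w σ τ θ| ≤ ∑' x : ι × κ, c x * (θ * σ x.1 + (1 - θ) * τ x.2) := by
    rw [affinity, ← Real.norm_eq_abs]
    exact tsum_of_norm_bounded (hc.summable_mean hσ hτ hσ1 hτ1 θ).hasSum
      fun x => abs_affinity_term_le hw hσ hτ hθ hθ1 x
  rw [hc.tsum_mean hσ hτ hσ1 hτ1] at h1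
  have h2 := (hc.summable_fst hσ hσ1).tsum_le_of_sum_le (hc.sum_mul_fst_le hσ hσ1)
  have h3 := (hc.summable_snd hτ hτ1).tsum_le_of_sum_le (hc.sum_mul_snd_le hτ hτ1)
  have h4 := mul_le_mul_of_nonneg_left h2 hθ.le
  have h5 := mul_le_mul_of_nonneg_left h3 (by linarith : 0 ≤ 1 - θ)
  linarith

/-- All the deviations `1 - affinity w σ τ θ` with `0 < θ < 1` are comparable. -/
theorem one_sub_affinity_le (hc : IsSubstochastic c) (hw : ∀ x, |w x| ≤ c x)
    (hσ : ∀ i, 0 ≤ σ i) (hτ : ∀ j, 0 ≤ τ j) (hσ1 : HasSum σ 1) (hτ1 : HasSum τ 1)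
    (hθ : 0 < θ) (hθ1 : θ < 1) (hη : 0 < η) (hη1 : η < 1) :
    1 - affinity w σ τ θ ≤ gapConst θ η * (1 - affinity w σ τ η) := by
  have hsub : ∀ {ζ : ℝ}, 0 < ζ → ζ < 1 →
      HasSum (fun x : ι × κ => c x * (ζ * σ x.1 + (1 - ζ) * τ x.2) -
        w x * (σ x.1 ^ ζ * τ x.2 ^ (1 - ζ)))
      (ζ * ∑' x : ι × κ, c x * σ x.1 + (1 - ζ) * ∑' x : ι × κ, c x * τ x.2 -
        affinity w σ τ ζ) := by
    intro ζ h0 h1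
    rw [← hc.tsum_mean hσ hτ hσ1 hτ1 ζ]
    exact (hc.summable_mean hσ hτ hσ1 hτ1 ζ).hasSum.sub
      (hc.summable_affinity hw hσ hτ hσ1 hτ1 h0 h1).hasSum
  have hle : ∀ x : ι × κ, c x * (θ * σ x.1 + (1 - θ) * τ x.2) -
      w x * (σ x.1 ^ θ * τ x.2 ^ (1 - θ)) ≤ gapConst θ η *
      (c x * (η * σ x.1 + (1 - η) * τ x.2) - w x * (σ x.1 ^ η * τ x.2 ^ (1 - η))) :=
    fun x => weighted_mean_sub_le hθ hθ1 hη hη1 (hσ x.1) (hτ x.2) (hw x)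
  have h1 := hasSum_le hle (hsub hθ hθ1) ((hsub hη hη1).mul_left (gapConst θ η))
  have h2 := (hc.summable_fst hσ hσ1).tsum_le_of_sum_le (hc.sum_mul_fst_le hσ hσ1)
  have h3 := (hc.summable_snd hτ hτ1).tsum_le_of_sum_le (hc.sum_mul_snd_le hτ hτ1)
  obtain ⟨hC1, hC2⟩ := le_gapConst (θ := θ) hη hη1
  generalize (∑' x : ι × κ, c x * σ x.1) = a at h1 h2
  generalize (∑' x : ι × κ, c x * τ x.2) = b at h1 h3
  -- The summed gaps start from `θ a + (1 - θ) b`, not from `1`. The missing masses `1 - a` and `1 -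
  -- b` are nonnegative and are compared separately, with the same constant.
  have h4 := mul_le_mul_of_nonneg_right (by linarith : θ ≤ gapConst θ η * η) (sub_nonneg.2 h2)
  have h5 := mul_le_mul_of_nonneg_right (by linarith : 1 - θ ≤ gapConst θ η * (1 - η))
    (sub_nonneg.2 h3)
  linarith

/-- Since `w ≤ (c + d) / 2` and the affinity of `d` is at most `1`, the affinity of `w` is at most
the average of `1` and the affinity of `c`. -/
theorem one_sub_affinity_le_two_mul (hc : IsSubstochastic c) (hd : IsSubstochastic d)
    (hw : ∀ x, |w x| ≤ (c x + d x) / 2)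
    (hσ : ∀ i, 0 ≤ σ i) (hτ : ∀ j, 0 ≤ τ j) (hσ1 : HasSum σ 1) (hτ1 : HasSum τ 1)
    (hθ : 0 < θ) (hθ1 : θ < 1) :
    1 - affinity c σ τ θ ≤ 2 * (1 - affinity w σ τ θ) := by
  have hc' : ∀ x, |c x| ≤ c x := fun x => (abs_of_nonneg (hc.nonneg x)).le
  have hd' : ∀ x, |d x| ≤ d x := fun x => (abs_of_nonneg (hd.nonneg x)).le
  have h1 := (abs_le.1 (hd.abs_affinity_le_one hd' hσ hτ hσ1 hτ1 hθ hθ1)).2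
  have h2 := hasSum_le (fun x => ?_)
    ((hc.half_add hd).summable_affinity hw hσ hτ hσ1 hτ1 hθ hθ1).hasSum
    (((hc.summable_affinity hc' hσ hτ hσ1 hτ1 hθ hθ1).hasSum.add
      (hd.summable_affinity hd' hσ hτ hσ1 hτ1 hθ hθ1).hasSum).div_const 2)
  · simp only [affinity] at h1 ⊢
    linarith
  · have h3 := hσ x.1
    have h4 := hτ x.2
    have h5 := mul_le_mul_of_nonneg_right ((le_abs_self _).trans (hw x))
      (by positivity : 0 ≤ σ x.1 ^ θ * τ x.2 ^ (1 - θ))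
    linarith

end IsSubstochastic

theorem sum_norm_sq_le_one {α : Type*} {y : α → ℂ} (hy : ∑' i, ‖y i‖ₑ ^ 2 ≤ 1) (F : Finset α) :
    ∑ i ∈ F, ‖y i‖ ^ 2 ≤ 1 := by
  rw [← ENNReal.ofReal_le_one, ENNReal.ofReal_sum_of_nonneg fun i _ => by positivity]
  simp_rw [ENNReal.ofReal_pow (norm_nonneg _), ofReal_norm]
  exact (ENNReal.sum_le_tsum F).trans hy

theorem isSubstochastic_of_tsum {ι κ : Type*} (z : ι × κ → ℂ)
    (hrow : ∀ i, ∑' j, ‖z (i, j)‖ₑ ^ 2 ≤ 1) (hcol : ∀ j, ∑' i, ‖z (i, j)‖ₑ ^ 2 ≤ 1) :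
    IsSubstochastic (fun x => ‖z x‖ ^ 2) :=
  ⟨fun _ => by positivity, fun i => sum_norm_sq_le_one (hrow i),
    fun j => sum_norm_sq_le_one (hcol j)⟩

/-! ### Overlap of two decompositions and the norming functional -/

/-- The matrix of real parts of `⟪k j, h i⟫ * ⟪g i, e j⟫`. -/
def overlap {ι κ : Type*} (g h : ι → H) (e k : κ → H) (x : ι × κ) : ℝ :=
  (⟪k x.2, h x.1⟫_ℂ * ⟪g x.1, e x.2⟫_ℂ).re

theorem abs_overlap_le {ι κ : Type*} (g h : ι → H) (e k : κ → H) (x : ι × κ) :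
    |overlap g h e k x| ≤ (‖⟪g x.1, e x.2⟫_ℂ‖ ^ 2 + ‖⟪k x.2, h x.1⟫_ℂ‖ ^ 2) / 2 := by
  refine (Complex.abs_re_le_norm _).trans ?_
  rw [norm_mul]
  nlinarith [sq_nonneg (‖⟪g x.1, e x.2⟫_ℂ‖ - ‖⟪k x.2, h x.1⟫_ℂ‖)]

theorem isSubstochastic_basis {ι κ : Type*} (g : HilbertBasis ι ℂ H) (e : HilbertBasis κ ℂ H) :
    IsSubstochastic (fun x : ι × κ => ‖⟪g x.1, e x.2⟫_ℂ‖ ^ 2) := by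
  refine isSubstochastic_of_tsum (fun x => ⟪g x.1, e x.2⟫_ℂ) (fun i => ?_) (fun j => ?_)
  · simp_rw [enorm_inner_symm (g i)]
    exact tsum_enorm_inner_sq_le_of_norm_le_one e.orthonormal (g.orthonormal.1 i).le
  · change ∑' i, ‖⟪g i, e j⟫_ℂ‖ₑ ^ 2 ≤ 1
    exact tsum_enorm_inner_sq_le_of_norm_le_one g.orthonormal (e.orthonormal.1 j).le

namespace IsSVD

variable {ι κ : Type*} {S T : H →L[ℂ] H} {g : HilbertBasis ι ℂ H} {s : ι → ℝ} {h : ι → H}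
  {e : HilbertBasis κ ℂ H} {t : κ → ℝ} {k : κ → H}

theorem isSubstochastic (hS : IsSVD S g s h) (hT : IsSVD T e t k) :
    IsSubstochastic (fun x : ι × κ => ‖⟪k x.2, h x.1⟫_ℂ‖ ^ 2) := by
  refine isSubstochastic_of_tsum (fun x => ⟪k x.2, h x.1⟫_ℂ) (fun i => ?_) (fun j => ?_)
  · exact hT.tsum_enorm_inner_le_one (hS.norm_le_one i)
  · simp_rw [enorm_inner_symm (k j)]
    exact hS.tsum_enorm_inner_le_one (hT.norm_le_one j)

theorem overlap_isSubstochastic (hS : IsSVD S g s h) (hT : IsSVD T e t k) :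
    IsSubstochastic (fun x : ι × κ =>
      (‖⟪g x.1, e x.2⟫_ℂ‖ ^ 2 + ‖⟪k x.2, h x.1⟫_ℂ‖ ^ 2) / 2) :=
  (isSubstochastic_basis g e).half_add (hS.isSubstochastic hT)

/-- The functional `Z ↦ ∑ t j ^ (q - 1) ⟪k j, Z (e j)⟫` attached to a unit vector `T` of `ℓ^q` has
norm at most `1`. -/
theorem pairing_le (hT : IsSVD T e t k) {q : ℝ} (hq : 1 < q) (hT1 : schattenTrace q T = 1)
    {Z : H →L[ℂ] H} (hZ : IsCompactOperator Z) {r : ℝ}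
    (hr : HasSum (fun j => t j ^ (q - 1) * (⟪k j, Z (e j)⟫_ℂ).re) r) :
    ENNReal.ofReal r ≤ schattenTrace q Z ^ (1 / q) := by
  have hq0 : 0 < q := by linarith
  have hconj : (q / (q - 1)).HolderConjugate q := (Real.HolderConjugate.conjExponent hq).symm
  have h1 : ∑' j, ‖⟪k j, Z (e j)⟫_ℂ‖ₑ ^ q ≤ schattenTrace q Z := by
    refine le_trans (le_of_eq ?_) (tsum_le_schattenTrace hq.le hZ
      (e.orthonormal.comp (fun j : {j // t j ≠ 0} => (j : κ)) Subtype.val_injective)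
      hT.orthonormal)
    refine (tsum_subtype_eq_of_support_subset (s := {j | t j ≠ 0})
      (f := fun j => ‖⟪k j, Z (e j)⟫_ℂ‖ₑ ^ q) ?_).symm
    intro j hj h0
    simp [hT.eq_zero j h0, hq0] at hj
  -- The coefficients `t j ^ (q - 1)` form a unit vector of the conjugate space, because `(q - 1) ·
  -- q / (q - 1) = q`.
  have h2 : ∑' j, (ENNReal.ofReal (t j) ^ (q - 1)) ^ (q / (q - 1)) = 1 := by
    rw [← hT1, hT.schattenTrace_eq hq0]
    refine tsum_congr fun j => ?_
    rw [← ENNReal.rpow_mul, mul_div_cancel₀ _ (by linarith)]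
  calc ENNReal.ofReal r ≤ ‖r‖ₑ := by
        rw [← ofReal_norm]; exact ENNReal.ofReal_le_ofReal (le_abs_self r)
    _ ≤ ∑' j, ‖t j ^ (q - 1) * (⟪k j, Z (e j)⟫_ℂ).re‖ₑ := by
        rw [← hr.tsum_eq]; exact enorm_tsum_le_tsum_enorm
    _ ≤ ∑' j, ENNReal.ofReal (t j) ^ (q - 1) * ‖⟪k j, Z (e j)⟫_ℂ‖ₑ := by
        refine ENNReal.tsum_le_tsum fun j => ?_
        rw [enorm_mul, ENNReal.ofReal_rpow_of_nonneg (hT.nonneg j) (by linarith), ← ofReal_norm,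
          Real.norm_of_nonneg (Real.rpow_nonneg (hT.nonneg j) _)]
        gcongr
        rw [← ofReal_norm, ← ofReal_norm]
        exact ENNReal.ofReal_le_ofReal (Complex.abs_re_le_norm _)
    _ ≤ _ := tsum_mul_le_Lp_mul_Lq _ _ hconj
    _ ≤ _ := by
        rw [h2, ENNReal.one_rpow, one_mul]
        gcongr

end IsSVD

/-! ### Unit vectors: affinity against Schatten distance -/

/-- A singular value decomposition with singular values `σ i ^ (1 / p)`, where `∑ σ i = 1`. -/
structure IsUnitSVD {ι : Type*} (p : ℝ) (T : H →L[ℂ] H) (g : HilbertBasis ι ℂ H) (σ : ι → ℝ)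
    (h : ι → H) : Prop where
  nonneg : ∀ i, 0 ≤ σ i
  hasSum : HasSum σ 1
  isSVD : IsSVD T g (fun i => σ i ^ (1 / p)) h

theorem exists_isUnitSVD {p : ℝ} (hp : 0 < p) {T : H →L[ℂ] H} (hT : IsCompactOperator T)
    (h1 : schattenTrace p T = 1) :
    ∃ (ι : Type u) (g : HilbertBasis ι ℂ H) (σ : ι → ℝ) (h : ι → H), IsUnitSVD p T g σ h := by
  obtain ⟨ι, g, s, h, hs⟩ := exists_isSVD hT
  refine ⟨ι, g, fun i => s i ^ p, h, fun i => Real.rpow_nonneg (hs.nonneg i) _, ?_, ?_⟩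
  · rw [hs.schattenTrace_eq hp] at h1
    have h2 : ∀ i, ENNReal.ofReal (s i) ^ p = ENNReal.ofReal (s i ^ p) := fun i =>
      ENNReal.ofReal_rpow_of_nonneg (hs.nonneg i) hp.le
    simp_rw [h2] at h1
    have h3 := ENNReal.hasSum_toReal (h1.trans_ne ENNReal.one_ne_top)
    rw [← ENNReal.tsum_toReal_eq fun _ => ENNReal.ofReal_ne_top, h1] at h3
    simpa only [ENNReal.toReal_ofReal (Real.rpow_nonneg (hs.nonneg _) _), ENNReal.toReal_one]
      using h3
  · have h2 : (fun i => (s i ^ p) ^ (1 / p)) = s := by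
      funext i
      rw [← Real.rpow_mul (hs.nonneg i), mul_one_div_cancel hp.ne', Real.rpow_one]
    rwa [h2]

namespace IsUnitSVD

variable {ι κ : Type*} {p q : ℝ} {S T : H →L[ℂ] H} {g : HilbertBasis ι ℂ H} {σ : ι → ℝ}
  {h : ι → H} {e : HilbertBasis κ ℂ H} {τ : κ → ℝ} {k : κ → H}

theorem schattenTrace_eq_one (hT : IsUnitSVD p T g σ h) (hp : 0 < p) : schattenTrace p T = 1 := by
  rw [hT.isSVD.schattenTrace_eq hp]
  have h1 : ∀ i, ENNReal.ofReal (σ i ^ (1 / p)) ^ p = ENNReal.ofReal (σ i) := by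
    intro i
    rw [ENNReal.ofReal_rpow_of_nonneg (Real.rpow_nonneg (hT.nonneg i) _) hp.le,
      ← Real.rpow_mul (hT.nonneg i), one_div_mul_cancel hp.ne', Real.rpow_one]
  simp_rw [h1]
  rw [← ENNReal.ofReal_tsum_of_nonneg hT.nonneg hT.hasSum.summable, hT.hasSum.tsum_eq,
    ENNReal.ofReal_one]

theorem isCompactOperator (hT : IsUnitSVD p T g σ h) (hp : 0 < p) : IsCompactOperator T := by
  refine hT.isSVD.isCompactOperator hp ?_
  rw [← hT.isSVD.schattenTrace_eq hp, hT.schattenTrace_eq_one hp]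
  exact ENNReal.one_ne_top

theorem mazurMap (hT : IsUnitSVD p T g σ h) (hp : 0 < p) (hq : 0 < q) :
    IsUnitSVD q (mazurMap p q T) g σ h := by
  refine ⟨hT.nonneg, hT.hasSum, ?_⟩
  convert hT.isSVD.mazurMap hp hq using 2 with i
  rw [← Real.rpow_mul (hT.nonneg i)]
  congr 1
  field_simp

theorem abs_rpow (hT : IsUnitSVD p T g σ h) (hp : 0 < p) (hq : 0 < q) :
    IsUnitSVD q (CFC.abs T ^ (p / q)) g σ (fun i => if σ i = 0 then 0 else g i) := by
  refine ⟨hT.nonneg, hT.hasSum, ?_⟩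
  convert hT.isSVD.abs_rpow (div_pos hp hq) using 2 with i i
  · rw [← Real.rpow_mul (hT.nonneg i)]
    congr 1
    field_simp
  · simp only [Real.rpow_eq_zero (hT.nonneg i) (one_div_pos.2 hp).ne']

/-- Identifies the affinity at `1 / p` with the norming functional of `T` evaluated at `S`: expand
`e j` in the basis `g`. The double series is summable over pairs, so it may be summed over `i`
first. -/
theorem hasSum_pairing (hS : IsUnitSVD p S g σ h) (hT : IsUnitSVD p T e τ k) (hp : 1 < p) :
    HasSum (fun j => (τ j ^ (1 / p)) ^ (p - 1) * (⟪k j, S (e j)⟫_ℂ).re)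
      (affinity (overlap g h e k) σ τ (1 / p)) := by
  have hp0 : 0 < p := by linarith
  have hθ1 : 1 / p < 1 := (div_lt_one hp0).2 hp
  have h1 := ((hS.isSVD.overlap_isSubstochastic hT.isSVD).summable_affinity
    (abs_overlap_le g h e k) hS.nonneg hT.nonneg hS.hasSum hT.hasSum (one_div_pos.2 hp0)
    hθ1).hasSum
  rw [← (Equiv.prodComm κ ι).hasSum_iff] at h1
  refine h1.prod_fiberwise fun j => ?_
  have h2 : (τ j ^ (1 / p)) ^ (p - 1) = τ j ^ (1 - 1 / p) := by
    rw [← Real.rpow_mul (hT.nonneg j)]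
    congr 1
    field_simp
  rw [h2]
  have h3 := Complex.hasSum_re ((g.hasSum_repr (e j)).mapL ((innerSL ℂ (k j)).comp S))
  refine (h3.mul_left (τ j ^ (1 - 1 / p))).congr_fun fun i => ?_
  simp only [Function.comp_apply, Equiv.prodComm_apply, Prod.swap_prod_mk, overlap,
    ContinuousLinearMap.comp_apply, map_smul, hS.isSVD.apply_basis, g.repr_apply_apply,
    smul_eq_mul, innerSL_apply_apply]
  rw [show ∀ a b c : ℂ, a * (b * c) = b * (c * a) by intros; ring, Complex.re_ofReal_mul]
  ring

theorem hasSum_pairing_self (hT : IsUnitSVD p T e τ k) (hp : 1 < p) :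
    HasSum (fun j => (τ j ^ (1 / p)) ^ (p - 1) * (⟪k j, T (e j)⟫_ℂ).re) 1 := by
  have hp0 : 0 < p := by linarith
  refine hT.hasSum.congr_fun fun j => ?_
  rw [hT.isSVD.apply_basis, inner_smul_right]
  by_cases h0 : τ j = 0
  · simp [h0, Real.zero_rpow (inv_ne_zero hp0.ne')]
  · rw [hT.isSVD.inner_self_eq_one
      (fun h1 => h0 ((Real.rpow_eq_zero (hT.nonneg j) (one_div_pos.2 hp0).ne').1 h1)), mul_one,
      Complex.ofReal_re, ← Real.rpow_mul (hT.nonneg j),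
      ← Real.rpow_add (lt_of_le_of_ne (hT.nonneg j) (Ne.symm h0)),
      show 1 / p * (p - 1) + 1 / p = 1 by field_simp; ring, Real.rpow_one]

/-- The norming functional of `T` takes the value `1` at `T` and the affinity at `S`; apply it to `T
- S`. -/
theorem one_sub_affinity_le (hS : IsUnitSVD p S g σ h) (hT : IsUnitSVD p T e τ k) (hp : 1 < p) :
    ENNReal.ofReal (1 - affinity (overlap g h e k) σ τ (1 / p)) ≤
      schattenTrace p (T - S) ^ (1 / p) := by
  have hp0 : 0 < p := by linarith
  refine hT.isSVD.pairing_le hp (hT.schattenTrace_eq_one hp0)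
    ((hT.isCompactOperator hp0).sub (hS.isCompactOperator hp0)) ?_
  refine ((hT.hasSum_pairing_self hp).sub (hS.hasSum_pairing hT hp)).congr_fun fun j => ?_
  rw [sub_apply, inner_sub_right, Complex.sub_re]
  ring

theorem abs_affinity_le_one (hS : IsUnitSVD p S g σ h) (hT : IsUnitSVD p T e τ k) {θ : ℝ}
    (hθ : 0 < θ) (hθ1 : θ < 1) : |affinity (overlap g h e k) σ τ θ| ≤ 1 :=
  (hS.isSVD.overlap_isSubstochastic hT.isSVD).abs_affinity_le_one (abs_overlap_le g h e k)
    hS.nonneg hT.nonneg hS.hasSum hT.hasSum hθ hθ1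

/-- The norming functional of `T` at `S + T` gives `‖S + T‖_q ≥ 1 + a`, where `a` is the affinity,
so Clarkson's inequality leaves at most `2 ^ q - (1 + a) ^ q` for `S - T`. -/
theorem schattenTrace_sub_le (hS : IsUnitSVD q S g σ h) (hT : IsUnitSVD q T e τ k) (hq : 2 ≤ q) :
    schattenTrace q (S - T) ≤
      ENNReal.ofReal (2 ^ q * q / 2 * (1 - affinity (overlap g h e k) σ τ (1 / q))) := by
  have hq0 : 0 < q := by linarith
  have hSc := hS.isCompactOperator hq0
  have hTc := hT.isCompactOperator hq0
  have hθ1 : 1 / q < 1 := (div_lt_one hq0).2 (by linarith)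
  have h1 : ENNReal.ofReal (1 + affinity (overlap g h e k) σ τ (1 / q)) ≤
      schattenTrace q (S + T) ^ (1 / q) := by
    refine hT.isSVD.pairing_le (by linarith) (hT.schattenTrace_eq_one hq0) (hSc.add hTc) ?_
    refine ((hT.hasSum_pairing_self (by linarith)).add
      (hS.hasSum_pairing hT (by linarith))).congr_fun fun j => ?_
    rw [add_apply, inner_add_right, Complex.add_re]
    ring
  obtain ⟨h2, h3⟩ := abs_le.1 (hS.abs_affinity_le_one hT (one_div_pos.2 hq0) hθ1)
  set a := affinity (overlap g h e k) σ τ (1 / q)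
  have h4 : ENNReal.ofReal ((1 + a) ^ q) ≤ schattenTrace q (S + T) := by
    rw [← ENNReal.ofReal_rpow_of_nonneg (by linarith) hq0.le, ← ENNReal.le_rpow_inv_iff hq0,
      ← one_div]
    exact h1
  have h5 : schattenTrace q (S + T) + schattenTrace q (S - T) ≤ ENNReal.ofReal (2 ^ q) := by
    refine (schattenTrace_add_sub_le hq hSc hTc).trans (le_of_eq ?_)
    rw [hS.schattenTrace_eq_one hq0, hT.schattenTrace_eq_one hq0, one_add_one_eq_two,
      ← ENNReal.ofReal_rpow_of_nonneg (by norm_num) hq0.le, ENNReal.ofReal_ofNat]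
    conv_lhs => rw [← ENNReal.rpow_one 2, ← ENNReal.rpow_mul, one_mul,
      ← ENNReal.rpow_add _ _ (by simp) (by simp), sub_add_cancel]
  have h6 : schattenTrace q (S - T) ≤ ENNReal.ofReal (2 ^ q - (1 + a) ^ q) := by
    rw [ENNReal.ofReal_sub _ (Real.rpow_nonneg (by linarith) q)]
    refine ENNReal.le_sub_of_add_le_left ENNReal.ofReal_ne_top (le_trans ?_ h5)
    gcongr
  refine h6.trans (ENNReal.ofReal_le_ofReal ?_)
  -- Bernoulli's inequality for `(1 + a) / 2 = 1 + (a - 1) / 2` makes the bound linear in `1 - a`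
  -- and produces the constant `2 ^ q q / 2`.
  have h7 := one_add_mul_self_le_rpow_one_add (s := (a - 1) / 2) (by linarith)
    (by linarith : 1 ≤ q)
  have h8 : (1 + a) ^ q = 2 ^ q * (1 + (a - 1) / 2) ^ q := by
    rw [← Real.mul_rpow (by norm_num) (by linarith)]
    congr 1
    ring
  have h9 := mul_le_mul_of_nonneg_left h7 (Real.rpow_nonneg (by norm_num : (0 : ℝ) ≤ 2) q)
  rw [h8]
  linarith

/-- For powers of `|S|` and `|T|` left and right singular vectors agree, so the overlap is `|⟪g i, e
j⟫|²`. Indices with `σ i = 0` or `τ j = 0` contribute nothing, as both exponents are positive. -/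
theorem affinity_overlap_basis {θ : ℝ} (hθ : 0 < θ) (hθ1 : θ < 1) :
    affinity (overlap g (fun i => if σ i = 0 then 0 else g i) e
      (fun j => if τ j = 0 then 0 else e j)) σ τ θ =
      affinity (fun x : ι × κ => ‖⟪g x.1, e x.2⟫_ℂ‖ ^ 2) σ τ θ := by
  refine tsum_congr fun x => ?_
  by_cases h1 : σ x.1 = 0
  · simp [h1, Real.zero_rpow hθ.ne']
  by_cases h2 : τ x.2 = 0
  · simp [h2, Real.zero_rpow (sub_pos.2 hθ1).ne']
  rw [overlap, if_neg h1, if_neg h2, ← inner_conj_symm (e x.2), mul_comm,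
    mul_comm ((starRingEnd ℂ) _),   Complex.mul_conj, Complex.normSq_eq_norm_sq, Complex.ofReal_re, mul_comm]

end IsUnitSVD

/-! ### The modulus of continuity -/

theorem tendsto_ofReal_mul_rpow {C r : ℝ} (hr : 0 < r) :
    Filter.Tendsto (fun δ : ℝ => ENNReal.ofReal (C * δ) ^ r) (nhds 0) (nhds 0) := by
  have h : Continuous fun δ : ℝ => ENNReal.ofReal (C * δ) ^ r :=
    ENNReal.continuous_rpow_const.comp (ENNReal.continuous_ofReal.comp (by fun_prop))
  have h1 := h.tendsto 0
  simpa [hr] using h1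

theorem one_sub_affinity_le_toReal {p θ : ℝ} (hp : 1 < p) (hθ : 0 < θ) (hθ1 : θ < 1)
    {ι κ : Type*} {S T : H →L[ℂ] H} {g : HilbertBasis ι ℂ H} {σ : ι → ℝ} {h : ι → H}
    {e : HilbertBasis κ ℂ H} {τ : κ → ℝ} {k : κ → H} (hS : IsUnitSVD p S g σ h)
    (hT : IsUnitSVD p T e τ k) (hfin : schattenTrace p (T - S) ≠ ∞) :
    1 - affinity (overlap g h e k) σ τ θ ≤
      gapConst θ (1 / p) * (schattenTrace p (T - S) ^ (1 / p)).toReal := by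
  have hp0 : 0 < p := by linarith
  have h1 := (hS.isSVD.overlap_isSubstochastic hT.isSVD).one_sub_affinity_le
    (abs_overlap_le g h e k) hS.nonneg hT.nonneg hS.hasSum hT.hasSum hθ hθ1 (one_div_pos.2 hp0)
    ((div_lt_one hp0).2 hp)
  refine h1.trans (mul_le_mul_of_nonneg_left ?_ (gapConst_nonneg hθ (one_div_pos.2 hp0)))
  exact (ENNReal.ofReal_le_iff_le_toReal
    (ENNReal.rpow_ne_top_of_nonneg (one_div_pos.2 hp0).le hfin)).1 (hS.one_sub_affinity_le hT hp)

theorem mazurMap_eq_mul_abs_rpow {p q s : ℝ} (hp : 0 < p) (hq : 0 < q) (hs : 0 < s)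
    (hqs : 1 / q = 1 / 2 + 1 / s) {ι : Type*} {T : H →L[ℂ] H} {g : HilbertBasis ι ℂ H}
    {σ : ι → ℝ} {h : ι → H} (hT : IsUnitSVD p T g σ h) :
    mazurMap p q T = mazurMap p 2 T * CFC.abs T ^ (p / s) := by
  refine eq_of_basis g fun i => ?_
  rw [mul_apply_eq_comp, (hT.mazurMap hp hq).isSVD.apply_basis,
    hT.isSVD.abs_rpow_apply (div_pos hp hs).le, map_smul,
    (hT.mazurMap hp two_pos).isSVD.apply_basis, smul_smul, ← Complex.ofReal_mul,
    ← Real.rpow_mul (hT.nonneg i), ← Real.rpow_add_of_nonneg (hT.nonneg i) (by positivity)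
      (by positivity)]
  congr 3
  rw [hqs]
  field_simp
  ring

/-- The Mazur map of the unit sphere of `ℓ^p` into that of `ℓ^q` has a modulus of continuity that
depends only on `p` and `q`. -/
theorem exists_modulus {p q : ℝ} (hp : 1 < p) (hq : 1 < q) :
    ∃ ω : ℝ → ℝ≥0∞, Filter.Tendsto ω (nhds 0) (nhds 0) ∧
      ∀ S T : H →L[ℂ] H, IsCompactOperator S → IsCompactOperator T → schattenTrace p S = 1 →
        schattenTrace p T = 1 → schattenTrace p (T - S) ≠ ∞ →
        schattenTrace q (mazurMap p q S - mazurMap p q T) ^ (1 / q) ≤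
          ω (schattenTrace p (T - S) ^ (1 / p)).toReal := by
  have hp0 : 0 < p := by linarith
  have hq0 : 0 < q := by linarith
  have hθ : ∀ {r : ℝ}, 1 < r → 0 < 1 / r ∧ 1 / r < 1 := fun {r} hr =>
    ⟨one_div_pos.2 (by linarith), (div_lt_one (by linarith)).2 hr⟩
  rcases le_or_gt 2 q with h2q | hq2
  · refine ⟨fun δ => ENNReal.ofReal (2 ^ q * q / 2 * gapConst (1 / q) (1 / p) * δ) ^ (1 / q),
      tendsto_ofReal_mul_rpow (one_div_pos.2 hq0), ?_⟩
    intro S T hSc hTc hS1 hT1 hfin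
    obtain ⟨ι, g, σ, h, hS⟩ := exists_isUnitSVD hp0 hSc hS1
    obtain ⟨κ, e, τ, k, hT⟩ := exists_isUnitSVD hp0 hTc hT1
    refine ENNReal.rpow_le_rpow ?_ (one_div_pos.2 hq0).le
    refine ((hS.mazurMap hp0 hq0).schattenTrace_sub_le (hT.mazurMap hp0 hq0) h2q).trans
      (ENNReal.ofReal_le_ofReal ?_)
    rw [mul_assoc]
    exact mul_le_mul_of_nonneg_left
      (one_sub_affinity_le_toReal hp (hθ hq).1 (hθ hq).2 hS hT hfin) (by positivity)
  · have hr : 0 < 1 / q - 1 / 2 := sub_pos.2 (one_div_lt_one_div_of_lt hq0 hq2)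
    -- Here `q > 1` is what forces `s ≥ 2`, so that Clarkson's inequality is available for the
    -- second factor too.
    obtain ⟨s, hs2, hqs⟩ : ∃ s : ℝ, 2 ≤ s ∧ 1 / q = 1 / 2 + 1 / s := by
      refine ⟨1 / (1 / q - 1 / 2), ?_, by rw [one_div_one_div]; ring⟩
      rw [le_one_div two_pos hr]
      linarith [(hθ hq).2]
    have hs0 : 0 < s := by linarith
    -- One term for each factor of `M_{p,2}(T) |T|^{p/s}`. The extra `2` in the second comes from
    -- `one_sub_affinity_le_two_mul`, the price of passing from the overlap of `S` and `T` to that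
    -- of `|S|` and `|T|`.
    refine ⟨fun δ => ENNReal.ofReal (2 ^ (2 : ℝ) * 2 / 2 * gapConst (1 / 2) (1 / p) * δ) ^
        (1 / 2 : ℝ) + ENNReal.ofReal (2 ^ s * s / 2 * (2 * gapConst (1 / s) (1 / p)) * δ) ^ (1 / s),
      ?_, ?_⟩
    · simpa using (tendsto_ofReal_mul_rpow (one_half_pos (α := ℝ))).add
        (tendsto_ofReal_mul_rpow (one_div_pos.2 hs0))
    intro S T hSc hTc hS1 hT1 hfin
    obtain ⟨ι, g, σ, h, hS⟩ := exists_isUnitSVD hp0 hSc hS1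
    obtain ⟨κ, e, τ, k, hT⟩ := exists_isUnitSVD hp0 hTc hT1
    have hA := hS.mazurMap hp0 two_pos
    have hB := hT.mazurMap hp0 two_pos
    have hD := hS.abs_rpow hp0 hs0
    have hE := hT.abs_rpow hp0 hs0
    have hAc := hA.isCompactOperator two_pos
    have hBc := hB.isCompactOperator two_pos
    have hDc := hD.isCompactOperator hs0
    have hEc := hE.isCompactOperator hs0
    -- Split `A D - B E = (A - B) D + B (D - E)`; in each product the undifferenced factor has norm
    -- `1`.
    rw [mazurMap_eq_mul_abs_rpow hp0 hq0 hs0 hqs hS, mazurMap_eq_mul_abs_rpow hp0 hq0 hs0 hqs hT,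
      ← sub_add_sub_cancel _ (mazurMap p 2 T * CFC.abs S ^ (p / s)), ← sub_mul, ← mul_sub]
    refine (schattenTrace_add_le hq.le ((hAc.sub hBc).comp_clm _)
      (hBc.comp_clm (CFC.abs S ^ (p / s) - CFC.abs T ^ (p / s)))).trans (add_le_add ?_ ?_)
    · refine (schattenTrace_mul_le hq.le hs2 hqs (hAc.sub hBc) hDc).trans ?_
      rw [hD.schattenTrace_eq_one hs0, ENNReal.one_rpow, mul_one]
      refine ENNReal.rpow_le_rpow ?_ one_half_pos.le
      refine (hA.schattenTrace_sub_le hB le_rfl).trans (ENNReal.ofReal_le_ofReal ?_)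
      rw [mul_assoc _ (gapConst _ _)]
      exact mul_le_mul_of_nonneg_left
        (one_sub_affinity_le_toReal hp one_half_pos one_half_lt_one hS hT hfin) (by positivity)
    · refine (schattenTrace_mul_le hq.le hs2 hqs hBc (hDc.sub hEc)).trans ?_
      rw [hB.schattenTrace_eq_one two_pos, ENNReal.one_rpow, one_mul]
      refine ENNReal.rpow_le_rpow ?_ (one_div_pos.2 hs0).le
      refine (hD.schattenTrace_sub_le hE hs2).trans (ENNReal.ofReal_le_ofReal ?_)
      have hθs := hθ (by linarith : 1 < s)
      rw [IsUnitSVD.affinity_overlap_basis hθs.1 hθs.2, mul_assoc _ (2 * gapConst _ _)]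
      refine mul_le_mul_of_nonneg_left ?_ (by positivity)
      have h1 := (isSubstochastic_basis g e).one_sub_affinity_le_two_mul
        (hS.isSVD.isSubstochastic hT.isSVD) (abs_overlap_le g h e k) hS.nonneg hT.nonneg hS.hasSum
        hT.hasSum hθs.1 hθs.2
      linarith [one_sub_affinity_le_toReal hp hθs.1 hθs.2 hS hT hfin]

/-! ### The Mazur map between unit spheres -/

namespace Schatten

variable {p q : ℝ} [Fact (1 ≤ p)] [Fact (1 ≤ q)]

theorem norm_eq_toReal_rpow (T : Schatten p H) :
    ‖T‖ = (schattenTrace p (toOperator T) ^ (1 / p)).toReal := by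
  rw [norm_def, ENNReal.toReal_rpow]

theorem norm_eq_one_iff (T : Schatten p H) : ‖T‖ = 1 ↔ schattenTrace p (toOperator T) = 1 := by
  have hp : 0 < p := by linarith [(Fact.out : 1 ≤ p)]
  rw [norm_def, ← ENNReal.toReal_eq_one_iff, ← Real.rpow_left_inj ENNReal.toReal_nonneg
    zero_le_one (one_div_pos.2 hp).ne', Real.one_rpow]

variable (p q) in
/-- The Mazur map between the unit spheres of `ℓ^p(H)` and `ℓ^q(H)`. -/
def sphereMazur (T : Metric.sphere (0 : Schatten p H) 1) : Metric.sphere (0 : Schatten q H) 1 :=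
  have hT : IsCompactOperator (mazurMap p q (toOperator T.1)) ∧
      schattenTrace q (mazurMap p q (toOperator T.1)) = 1 := by
    have hp : 0 < p := by linarith [(Fact.out : 1 ≤ p)]
    have hq : 0 < q := by linarith [(Fact.out : 1 ≤ q)]
    obtain ⟨ι, g, σ, h, hS⟩ := exists_isUnitSVD hp T.1.isCompactOperator
      ((norm_eq_one_iff T.1).1 (mem_sphere_zero_iff_norm.1 T.2))
    exact ⟨(hS.mazurMap hp hq).isCompactOperator hq, (hS.mazurMap hp hq).schattenTrace_eq_one hq⟩
  ⟨(⟨mazurMap p q (toOperator T.1), hT.1, hT.2.trans_lt ENNReal.one_lt_top⟩ : schattenIdeal q H),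
    mem_sphere_zero_iff_norm.2 ((norm_eq_one_iff (p := q) _).2 hT.2)⟩

theorem toOperator_sphereMazur (T : Metric.sphere (0 : Schatten p H) 1) :
    toOperator (sphereMazur p q T).1 = mazurMap p q (toOperator T.1) := rfl

theorem exists_isUnitSVD_sphere (T : Metric.sphere (0 : Schatten p H) 1) :
    ∃ (ι : Type u) (g : HilbertBasis ι ℂ H) (σ : ι → ℝ) (h : ι → H),
      IsUnitSVD p (toOperator T.1) g σ h :=
  exists_isUnitSVD (by linarith [(Fact.out : 1 ≤ p)]) T.1.isCompactOperator
    ((norm_eq_one_iff T.1).1 (mem_sphere_zero_iff_norm.1 T.2))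

/-- Both maps keep the data `g`, `σ`, `h`, so the composite has the singular values `σ i ^ (1 / p)`
of `T` again and agrees with `T` on the basis `g`. -/
theorem sphereMazur_sphereMazur (T : Metric.sphere (0 : Schatten p H) 1) :
    sphereMazur q p (sphereMazur p q T) = T := by
  have hp : 0 < p := by linarith [(Fact.out : 1 ≤ p)]
  have hq : 0 < q := by linarith [(Fact.out : 1 ≤ q)]
  obtain ⟨ι, g, σ, h, hT⟩ := exists_isUnitSVD_sphere T
  refine Subtype.ext (toOperator_injective ?_)
  rw [toOperator_sphereMazur, toOperator_sphereMazur]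
  refine eq_of_basis g fun i => ?_
  rw [((hT.mazurMap hp hq).mazurMap hq hp).isSVD.apply_basis, hT.isSVD.apply_basis]

theorem uniformContinuous_sphereMazur (hp : 1 < p) (hq : 1 < q) :
    UniformContinuous (sphereMazur p q (H := H)) := by
  obtain ⟨ω, hω, hle⟩ := exists_modulus (H := H) hp hq
  rw [Metric.uniformContinuous_iff]
  intro ε hε
  obtain ⟨δ, hδ, hδε⟩ := Metric.eventually_nhds_iff.1
    (hω.eventually_lt_const (ENNReal.ofReal_pos.2 hε))
  refine ⟨δ, hδ, fun {S T} hST => ?_⟩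
  have h1 := hle _ _ S.1.isCompactOperator T.1.isCompactOperator
    ((norm_eq_one_iff S.1).1 (mem_sphere_zero_iff_norm.1 S.2))
    ((norm_eq_one_iff T.1).1 (mem_sphere_zero_iff_norm.1 T.2))
    (by rw [← map_sub]; exact (schattenTrace_lt_top _).ne)
  rw [← map_sub, ← norm_eq_toReal_rpow, ← toOperator_sphereMazur (q := q),
    ← toOperator_sphereMazur (q := q), ← map_sub] at h1
  have h2 : dist ‖T.1 - S.1‖ 0 < δ := by
    rwa [dist_zero_right, norm_norm, ← dist_eq_norm, dist_comm]
  rw [Subtype.dist_eq, dist_eq_norm, norm_eq_toReal_rpow]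
  exact (ENNReal.lt_ofReal_iff_toReal_lt (h1.trans_lt ((hδε h2).trans ENNReal.ofReal_lt_top)).ne).1
    (h1.trans_lt (hδε h2))

end Schatten

end

end NCMazur

theorem corollary5p6 {H : Type*} [NormedAddCommGroup H] [InnerProductSpace ℂ H] [CompleteSpace H]
    (p q : ℝ) [Fact (1 ≤ p)] [Fact (1 ≤ q)] (hp : 1 < p) (hq : 1 < q) :
    ∃ Φ : Metric.sphere (0 : NCMazur.Schatten p H) 1 ≃ₜ Metric.sphere (0 : NCMazur.Schatten q H) 1,
      (∀ T, (Φ T : NCMazur.Schatten q H).toOperator =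
        NCMazur.mazurMap p q (T : NCMazur.Schatten p H).toOperator) ∧
      (∀ S, (Φ.symm S : NCMazur.Schatten p H).toOperator =
        NCMazur.mazurMap q p (S : NCMazur.Schatten q H).toOperator) ∧
      UniformContinuous Φ ∧ UniformContinuous Φ.symm := by
  have huc := NCMazur.Schatten.uniformContinuous_sphereMazur (H := H) hp hq
  have huc' := NCMazur.Schatten.uniformContinuous_sphereMazur (H := H) hq hp
  exact ⟨⟨⟨NCMazur.Schatten.sphereMazur p q, NCMazur.Schatten.sphereMazur q p,
      NCMazur.Schatten.sphereMazur_sphereMazur, NCMazur.Schatten.sphereMazur_sphereMazur⟩,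
      huc.continuous, huc'.continuous⟩,
    NCMazur.Schatten.toOperator_sphereMazur, NCMazur.Schatten.toOperator_sphereMazur, huc, huc'⟩
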